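/- Let $\Lambda=\mathbb Z\times\mathbb Z\times\frac1{\sqrt2}\mathbb Z\subset\mathbb R^3$, $$\tau=\begin{pmatrix}0&-1&0\\-1&0&0\\0&0&-1\end{pmatrix},\qquad \rho=\begin{pmatrix}-1&0&0\\0&-1&0\\0&0&1\end{pmatrix},\qquad A=\begin{pmatrix}-\frac12&-\frac12&\frac1{\sqrt2}\\ \frac12&\frac12&\frac1{\sqrt2}\\ \frac1{\sqrt2}&-\frac1{\sqrt2}&0\end{pmatrix},$$ and write $L_b$ for the translation $x\mapsto x+b$ of $\mathbb R^3$. Let $\Gamma_1$ (resp. $\Gamma_2$) be the group of isometries of $\mathbb R^3$ generated by $L_\Lambda=\{L_\lambda\mid\lambda\in\Lambda\}$ and $\tau$ (resp. $\rho$), and let $\mathcal O_i=\Gamma_i\backslash\mathbb R^3$. The isotropy group of the image of $x$ in $\mathcal O_i$ is the stabilizer of $x$ in $\Gamma_i$, and the singular set consists of the points with nontrivial isotropy group. Smooth $k$-forms on $\mathcal O_i$ are the $\Gamma_i$-invariant smooth $k$-forms on $\mathbb R^3$, with Laplace operator $dd^*+d^*d$. Let $\Lambda'=\operatorname{span}_{\mathbb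 Z}\{(1,1,0),(1,-1,0),(0,0,\sqrt2)\}$ and let $T=\mathbb R^3/\Lambda'$ be the associated flat torus. For an isometry $\gamma$ of $\mathbb R^3$ which descends to $T$ let $\overline\gamma$ be the induced isometry of $T$. Then: 1. $\Gamma_1=\{\tau^jL_\lambda\mid j\in\{0,1\},\lambda\in\Lambda\}$ and $\Gamma_2=\{\rho^jL_\lambda\mid j\in\{0,1\},\lambda\in\Lambda\}$; both act properly discontinuously with compact quotient on $\mathbb R^3$, so that $\mathcal O_1,\mathcal O_2$ are compact flat orbifolds. 2. Every nontrivial isotropy group of $\mathcal O_1$ and of $\mathcal O_2$ is isomorphic to $\mathbb Z_2$. The points of $\mathbb R^3$ with nontrivial stabilizer in $\Gamma_1$ are those with $x_3\in\frac1{2\sqrt2}\mathbb Z$ and $x_1+x_2\in\mathbb Z$; those with nontrivial stabilizer in $\Gamma_2$ are the ones with $x_1,x_2\in\frac12\mathbb Z$. The singular set of $\mathcal O_1$ is a disjoint union of two circles of length $\sqrt2$, the singular set of $\mathcal O_2$ is a disjoint union of four circles of length $\frac1{\sqrt2}$, and the two singular sets are not homeomorphic. 3. $\Lambda'$ is a sublattice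 of index four of $\Lambda$ and $T$ is compact. Let $G_1=\{\overline{\tau^jL_\lambda}\mid j\in\{0,1\},\lambda\in\Lambda\}$ and $G_2=\{\overline{\rho^jL_\lambda}\mid j\in\{0,1\},\lambda\in\Lambda\}$, let $H\subset O(3)$ be the subgroup generated by $\tau,\rho,A$, and let $G=\{\overline{BL_b}\mid B\in H,\ b\in\mathbb R^3,\ 4b\in\Lambda'\}$. Then $G$ is a finite subgroup of the isometry group of $T$, $G_1$ and $G_2$ are subgroups of $G$ with eight elements each, and $G_1,G_2$ are almost conjugate in $G$: each conjugacy class of $G$ contains equally many elements of $G_1$ and of $G_2$. Moreover $\mathcal O_i$ is isometric, as a Riemannian orbifold, to $G_i\backslash T$ for $i=1,2$. Thus $\mathcal O_1$ and $\mathcal O_2$ are Sunada-isospectral (that is, isometric to quotients of a common compact Riemannian manifold by finite groups which are almost conjugate in a group of isometries). 4. $\mathcal O_1$ and $\mathcal O_2$ are isospectral on $k$-forms for every $k\ge0$: every real number is an eigenvalue of the Laplace operators on smooth $k$-forms of $\mathcal O_1$ and of $\mathcal O_2$ with the same, finite multiplicity (possibly zero). -/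

import Mathlib

open scoped ContDiff Topology Matrix

noncomputable section

namespace FlatOrbifold

/-! ### Good orbifolds: quotients of a space by a group of isometries -/

section Good

variable {X Y : Type*} [PseudoMetricSpace X] [PseudoMetricSpace Y]

/-- The full isometry group of `X` (with composition as multiplication) acts on `X`. -/
instance isometryAction : MulAction (X ≃ᵢ X) X where
  smul γ x := γ x
  one_smul _ := rfl
  mul_smul _ _ _ := rfl

theorem smul_eq_apply (γ : X ≃ᵢ X) (x : X) : γ • x = γ x := rfl

/-- The underlying space `Γ \ X` of the orbifold, with the quotient topology. -/
abbrev OrbitSpace (Γ : Subgroup (X ≃ᵢ X)) : Type _ := MulAction.orbitRel.Quotient Γ X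

/-- The canonical projection `X → Γ \ X`. -/
def proj (Γ : Subgroup (X ≃ᵢ X)) (x : X) : OrbitSpace Γ :=
  Quotient.mk (MulAction.orbitRel Γ X) x

/-- The isotropy group at (the image of) `x`: the stabilizer of `x` in `Γ`. -/
abbrev isotropy (Γ : Subgroup (X ≃ᵢ X)) (x : X) : Subgroup Γ := MulAction.stabilizer Γ x

/-- The singular set: the points of `Γ \ X` with nontrivial isotropy group. -/
def singularSet (Γ : Subgroup (X ≃ᵢ X)) : Set (OrbitSpace Γ) :=
  {p | ∃ x : X, proj Γ x = p ∧ isotropy Γ x ≠ ⊥}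

/-- The quotient distance on `Γ \ X`: the distance between two orbits. -/
def orbitDist (Γ : Subgroup (X ≃ᵢ X)) (p q : OrbitSpace Γ) : ℝ :=
  sInf {d : ℝ | ∃ x y : X, proj Γ x = p ∧ proj Γ y = q ∧ d = dist x y}

/-- The subset `S` of `Γ \ X` is a disjoint union of `m` circles of length `ℓ`: it is homeomorphic
to the topological sum of `m` copies of `ℝ / ℓℤ`, by a map that is locally distance preserving on
each copy. -/
def IsDisjointUnionOfCircles (Γ : Subgroup (X ≃ᵢ X)) (S : Set (OrbitSpace Γ)) (m : ℕ) (ℓ : ℝ) :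
    Prop :=
  ∃ h : Fin m × AddCircle ℓ ≃ₜ S, ∀ (i : Fin m) (t : AddCircle ℓ), ∃ U ∈ 𝓝 t,
    ∀ s ∈ U, ∀ s' ∈ U, orbitDist Γ (h (i, s)) (h (i, s')) = dist s s'

/-- The orbifolds `Γ \ X` and `Γ' \ Y` are isometric: there is a homeomorphism of the underlying
spaces which near every point lifts to an isometry between metric balls in `X` and `Y`. -/
def OrbifoldIsometric (Γ : Subgroup (X ≃ᵢ X)) (Γ' : Subgroup (Y ≃ᵢ Y)) : Prop :=
  ∃ f : OrbitSpace Γ ≃ₜ OrbitSpace Γ', ∀ x : X, ∃ y : Y, f (proj Γ x) = proj Γ' y ∧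
    ∃ r > 0, ∃ φ : Metric.ball x r ≃ᵢ Metric.ball y r,
      (∀ z : Metric.ball x r, (z : X) = x → (φ z : Y) = y) ∧
      ∀ z : Metric.ball x r, f (proj Γ (z : X)) = proj Γ' (φ z : Y)

end Good

/-- Two finite subgroups of `G` are almost conjugate in `G` if every conjugacy class of `G` meets
them in the same number of elements. -/
def AlmostConjugate {G : Type*} [Group G] (K₁ K₂ : Subgroup G) : Prop :=
  Finite K₁ ∧ Finite K₂ ∧
    ∀ b : G, (conjugatesOf b ∩ (K₁ : Set G)).ncard = (conjugatesOf b ∩ (K₂ : Set G)).ncard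

/-! ### Differential forms and the Laplace operator on flat orbifolds `Γ \ ℝⁿ` -/

section Forms

variable {n : ℕ}

/-- (Not necessarily smooth) differential `k`-forms on `ℝⁿ`. -/
abbrev Form (n k : ℕ) : Type :=
  EuclideanSpace ℝ (Fin n) → EuclideanSpace ℝ (Fin n) [⋀^Fin k]→L[ℝ] ℝ

/-- The codifferential `d* θ = - ∑ᵢ ι(eᵢ) ∂ᵢθ` on Euclidean space. -/
def codiff {k : ℕ} (θ : Form n (k + 1)) : Form n k := fun x =>
  -∑ i : Fin n, (fderiv ℝ θ x (EuclideanSpace.single i 1)).curryLeft (EuclideanSpace.single i 1)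

/-- The Laplace operator `d d* + d* d` on `k`-forms on `ℝⁿ`; on functions it is `d* d`. -/
def formLaplacian : {k : ℕ} → Form n k → Form n k
  | 0, θ => codiff (extDeriv θ)
  | _ + 1, θ => extDeriv (codiff θ) + codiff (extDeriv θ)

/-- The pullback `γ^* θ`. -/
def pullback {k : ℕ} (γ : EuclideanSpace ℝ (Fin n) ≃ᵢ EuclideanSpace ℝ (Fin n)) (θ : Form n k) :
    Form n k := fun x => (θ (γ x)).compContinuousLinearMap (fderiv ℝ γ x)

theorem contDiff_extDeriv {k : ℕ} {θ : Form n k} (h : ContDiff ℝ ∞ θ) :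
    ContDiff ℝ ∞ (extDeriv θ) :=
  (ContinuousAlternatingMap.alternatizeUncurryFinCLM ℝ (EuclideanSpace ℝ (Fin n)) ℝ).contDiff.comp
    (h.fderiv_right (by simp))

theorem contDiff_codiff {k : ℕ} {θ : Form n (k + 1)} (h : ContDiff ℝ ∞ θ) :
    ContDiff ℝ ∞ (codiff θ) := by
  refine ContDiff.neg (ContDiff.sum fun i _ => ?_)
  have h1 : ContDiff ℝ ∞ fun x => fderiv ℝ θ x (EuclideanSpace.single i 1) :=
    (h.fderiv_right (by simp)).clm_apply contDiff_const
  have h0 : ContDiff ℝ ∞ fun f : EuclideanSpace ℝ (Fin n) [⋀^Fin (k + 1)]→L[ℝ] ℝ =>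
      f.curryLeft :=
    LinearIsometry.contDiff (𝕜 := ℝ) (E := EuclideanSpace ℝ (Fin n) [⋀^Fin (k + 1)]→L[ℝ] ℝ)
      (F := EuclideanSpace ℝ (Fin n) →L[ℝ] EuclideanSpace ℝ (Fin n) [⋀^Fin k]→L[ℝ] ℝ)
      ContinuousAlternatingMap.curryLeftLI
  have h2 : ContDiff ℝ ∞ fun x => (fderiv ℝ θ x (EuclideanSpace.single i 1)).curryLeft :=
    h0.comp h1
  exact h2.clm_apply contDiff_const

theorem extDeriv_add_smul {k : ℕ} {θ η : Form n k} (hθ : ContDiff ℝ ∞ θ) (hη : ContDiff ℝ ∞ η)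
    (a : ℝ) : extDeriv (a • θ + η) = a • extDeriv θ + extDeriv η := by
  funext x
  have h1 : DifferentiableAt ℝ (a • θ) x := (hθ.const_smul a).differentiable (by simp) x
  rw [extDeriv_add h1 (hη.differentiable (by simp) x), extDeriv_smul]
  rfl

theorem codiff_add_smul {k : ℕ} {θ η : Form n (k + 1)} (hθ : ContDiff ℝ ∞ θ)
    (hη : ContDiff ℝ ∞ η) (a : ℝ) : codiff (a • θ + η) = a • codiff θ + codiff η := by
  funext x
  have h0 : DifferentiableAt ℝ θ x := hθ.differentiable (by simp) x
  have h1 : DifferentiableAt ℝ (a • θ) x := (hθ.const_smul a).differentiable (by simp) x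
  have h2 : DifferentiableAt ℝ η x := hη.differentiable (by simp) x
  ext v
  simp [codiff, fderiv_add h1 h2, fderiv_const_smul h0, Finset.sum_add_distrib, Finset.mul_sum]
  ring

theorem formLaplacian_add_smul {k : ℕ} {θ η : Form n k} (hθ : ContDiff ℝ ∞ θ)
    (hη : ContDiff ℝ ∞ η) (a : ℝ) :
    formLaplacian (a • θ + η) = a • formLaplacian θ + formLaplacian η := by
  cases k with
  | zero =>
    simp only [formLaplacian]
    rw [extDeriv_add_smul hθ hη, codiff_add_smul (contDiff_extDeriv hθ) (contDiff_extDeriv hη)]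
  | succ k =>
    simp only [formLaplacian]
    rw [extDeriv_add_smul hθ hη, codiff_add_smul (contDiff_extDeriv hθ) (contDiff_extDeriv hη),
      codiff_add_smul hθ hη, extDeriv_add_smul (contDiff_codiff hθ) (contDiff_codiff hη)]
    module

theorem pullback_add_smul {k : ℕ} (γ : EuclideanSpace ℝ (Fin n) ≃ᵢ EuclideanSpace ℝ (Fin n))
    (θ η : Form n k) (a : ℝ) : pullback γ (a • θ + η) = a • pullback γ θ + pullback γ η := rfl

/-- The smooth `k`-forms on `Γ \ ℝⁿ` (that is, the `Γ`-invariant smooth `k`-forms on `ℝⁿ`) which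
are eigenforms of the Laplace operator with eigenvalue `c`, together with `0`. -/
def eigenforms (Γ : Subgroup (EuclideanSpace ℝ (Fin n) ≃ᵢ EuclideanSpace ℝ (Fin n))) (k : ℕ)
    (c : ℝ) : Submodule ℝ (Form n k) where
  carrier := {θ | ContDiff ℝ ∞ θ ∧ (∀ γ ∈ Γ, pullback γ θ = θ) ∧ formLaplacian θ = c • θ}
  zero_mem' := by
    refine ⟨contDiff_const, fun γ _ => rfl, ?_⟩
    have h := formLaplacian_add_smul (n := n) (k := k) (θ := 0) (η := 0) contDiff_const
      contDiff_const 1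
    simpa using h
  add_mem' := by
    rintro θ η ⟨h1, h2, h3⟩ ⟨h4, h5, h6⟩
    refine ⟨h1.add h4, fun γ hγ => ?_, ?_⟩
    · have h := pullback_add_smul γ θ η 1
      rw [one_smul, one_smul, h2 γ hγ, h5 γ hγ] at h
      exact h
    · have h := formLaplacian_add_smul h1 h4 1
      rw [one_smul, one_smul, h3, h6] at h
      rw [h, smul_add]
  smul_mem' := by
    rintro a θ ⟨h1, h2, h3⟩
    have h0 : formLaplacian (0 : Form n k) = 0 := by
      have h := formLaplacian_add_smul (n := n) (k := k) (θ := 0) (η := 0) contDiff_const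
        contDiff_const 1
      simpa using h
    refine ⟨h1.const_smul a, fun γ hγ => ?_, ?_⟩
    · have h := pullback_add_smul γ θ 0 a
      rw [h2 γ hγ] at h
      rw [add_zero] at h
      rw [h]
      exact add_zero _
    · have h := formLaplacian_add_smul (η := 0) h1 contDiff_const a
      rw [add_zero, h0, add_zero, h3] at h
      rw [h, smul_comm]

/-- `Γ \ ℝⁿ` and `Γ' \ ℝⁿ` are isospectral on `k`-forms: every real number is an eigenvalue of
the two Laplace operators on `k`-forms with the same, finite multiplicity (possibly `0`). -/
def IsospectralOnForms (Γ Γ' : Subgroup (EuclideanSpace ℝ (Fin n) ≃ᵢ EuclideanSpace ℝ (Fin n)))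
    (k : ℕ) : Prop :=
  ∀ c : ℝ, FiniteDimensional ℝ (eigenforms Γ k c) ∧ FiniteDimensional ℝ (eigenforms Γ' k c) ∧
    Module.finrank ℝ (eigenforms Γ k c) = Module.finrank ℝ (eigenforms Γ' k c)

end Forms

/-! ### Isometries of `ℝⁿ` and of flat tori -/

section Isometries

variable {n : ℕ}

/-- The translation `L_b : x ↦ x + b`. -/
def L (b : EuclideanSpace ℝ (Fin n)) : EuclideanSpace ℝ (Fin n) ≃ᵢ EuclideanSpace ℝ (Fin n) :=
  IsometryEquiv.addRight b

/-- The group `L_Λ` of translations by vectors in `Λ`. -/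
def translations (Λ : AddSubgroup (EuclideanSpace ℝ (Fin n))) :
    Subgroup (EuclideanSpace ℝ (Fin n) ≃ᵢ EuclideanSpace ℝ (Fin n)) where
  carrier := {γ | ∃ b ∈ Λ, γ = L b}
  one_mem' := ⟨0, Λ.zero_mem, by ext x; simp [L]⟩
  mul_mem' := by
    rintro _ _ ⟨b, hb, rfl⟩ ⟨c, hc, rfl⟩
    exact ⟨c + b, Λ.add_mem hc hb, by ext x; simp [L, add_assoc]⟩
  inv_mem' := by
    rintro _ ⟨b, hb, rfl⟩
    refine ⟨-b, Λ.neg_mem hb, ?_⟩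
    rw [inv_eq_iff_mul_eq_one]
    ext x
    simp [L]

theorem norm_mulVec {M : Matrix (Fin n) (Fin n) ℝ} (h : Mᵀ * M = 1) (v : Fin n → ℝ) :
    ‖WithLp.toLp 2 (M *ᵥ v)‖ = ‖WithLp.toLp 2 v‖ := by
  have key : ∀ w : Fin n → ℝ, ∑ i, ‖w i‖ ^ 2 = w ⬝ᵥ w := fun w => by
    simp [dotProduct, sq]
  rw [EuclideanSpace.norm_eq, EuclideanSpace.norm_eq]
  congr 1
  change ∑ i, ‖(M *ᵥ v) i‖ ^ 2 = ∑ i, ‖v i‖ ^ 2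
  rw [key, key, Matrix.dotProduct_mulVec, ← Matrix.mulVec_transpose, Matrix.mulVec_mulVec, h,
    Matrix.one_mulVec]

/-- The isometry `x ↦ M x` of `ℝⁿ` given by an orthogonal matrix `M`. -/
def linearIsometry (M : Matrix (Fin n) (Fin n) ℝ) (h : Mᵀ * M = 1) :
    EuclideanSpace ℝ (Fin n) ≃ᵢ EuclideanSpace ℝ (Fin n) where
  toFun x := WithLp.toLp 2 (M *ᵥ x.ofLp)
  invFun x := WithLp.toLp 2 (Mᵀ *ᵥ x.ofLp)
  left_inv x := by simp [Matrix.mulVec_mulVec, h]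
  right_inv x := by simp [Matrix.mulVec_mulVec, mul_eq_one_comm.mp h]
  isometry_toFun := by
    refine Isometry.of_dist_eq fun x y => ?_
    rw [dist_eq_norm, dist_eq_norm, ← WithLp.toLp_sub, ← Matrix.mulVec_sub, norm_mulVec h]
    rfl

/-- The flat torus `T_Λ = ℝⁿ / Λ` with the quotient metric. -/
abbrev Torus (Λ : AddSubgroup (EuclideanSpace ℝ (Fin n))) : Type := EuclideanSpace ℝ (Fin n) ⧸ Λ

/-- The isometry `f` of `T_Λ` is induced by the isometry `γ` of `ℝⁿ`, that is, `f = γ̄`. -/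
def IsInducedBy (Λ : AddSubgroup (EuclideanSpace ℝ (Fin n))) (f : Torus Λ ≃ᵢ Torus Λ)
    (γ : EuclideanSpace ℝ (Fin n) ≃ᵢ EuclideanSpace ℝ (Fin n)) : Prop :=
  ∀ x : EuclideanSpace ℝ (Fin n), f (QuotientAddGroup.mk x) = QuotientAddGroup.mk (γ x)

/-- The group of isometries of `T_Λ` that are induced by elements of `Γ`. -/
def descend (Λ : AddSubgroup (EuclideanSpace ℝ (Fin n)))
    (Γ : Subgroup (EuclideanSpace ℝ (Fin n) ≃ᵢ EuclideanSpace ℝ (Fin n))) :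
    Subgroup (Torus Λ ≃ᵢ Torus Λ) where
  carrier := {f | ∃ γ ∈ Γ, IsInducedBy Λ f γ}
  one_mem' := ⟨1, Γ.one_mem, fun _ => rfl⟩
  mul_mem' := by
    rintro f g ⟨γ, hγ, hf⟩ ⟨δ, hδ, hg⟩
    refine ⟨γ * δ, Γ.mul_mem hγ hδ, fun x => ?_⟩
    change f (g _) = QuotientAddGroup.mk (γ (δ x))
    rw [hg, hf]
  inv_mem' := by
    rintro f ⟨γ, hγ, hf⟩
    refine ⟨γ⁻¹, Γ.inv_mem hγ, fun x => ?_⟩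
    change f.symm _ = QuotientAddGroup.mk (γ.symm x)
    rw [IsometryEquiv.symm_apply_eq, hf, IsometryEquiv.apply_symm_apply]

end Isometries

/-! ### The two orbifolds -/

/-- Euclidean three-space. -/
abbrev E3 : Type := EuclideanSpace ℝ (Fin 3)

/-- The lattice `ℤ × ℤ × (1/√2)ℤ`. -/
def lattice : AddSubgroup E3 where
  carrier := {x | (∃ a : ℤ, (x 0 : ℝ) = a) ∧ (∃ b : ℤ, (x 1 : ℝ) = b) ∧ ∃ c : ℤ, (x 2 : ℝ) = c / √2}
  zero_mem' := ⟨⟨0, by simp⟩, ⟨0, by simp⟩, ⟨0, by simp⟩⟩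
  add_mem' := by
    rintro x y ⟨⟨a, ha⟩, ⟨b, hb⟩, ⟨c, hc⟩⟩ ⟨⟨a', ha'⟩, ⟨b', hb'⟩, ⟨c', hc'⟩⟩
    exact ⟨⟨a + a', by simp [ha, ha']⟩, ⟨b + b', by simp [hb, hb']⟩,
      ⟨c + c', by simp [hc, hc', add_div]⟩⟩
  neg_mem' := by
    rintro x ⟨⟨a, ha⟩, ⟨b, hb⟩, ⟨c, hc⟩⟩
    exact ⟨⟨-a, by simp [ha]⟩, ⟨-b, by simp [hb]⟩, ⟨-c, by simp [hc, neg_div]⟩⟩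

/-- The lattice spanned by `(1,1,0)`, `(1,-1,0)`, `(0,0,√2)`. -/
def lattice' : AddSubgroup E3 :=
  AddSubgroup.closure {!₂[1, 1, 0], !₂[1, -1, 0], !₂[0, 0, √2]}

/-- The lattice `Λ'/4`, where `Λ'` is `lattice'`. -/
def quarterLattice' : AddSubgroup E3 := lattice'.comap (nsmulAddMonoidHom 4)

def τ : E3 ≃ᵢ E3 :=
  linearIsometry !![0, -1, 0; -1, 0, 0; 0, 0, -1] (by
    ext i j; fin_cases i <;> fin_cases j <;> simp [Matrix.mul_apply, Fin.sum_univ_three])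

def ρ : E3 ≃ᵢ E3 :=
  linearIsometry !![-1, 0, 0; 0, -1, 0; 0, 0, 1] (by
    ext i j; fin_cases i <;> fin_cases j <;> simp [Matrix.mul_apply, Fin.sum_univ_three])

def A : E3 ≃ᵢ E3 :=
  linearIsometry !![-1 / 2, -1 / 2, 1 / √2; 1 / 2, 1 / 2, 1 / √2; 1 / √2, -1 / √2, 0] (by
    have h : (√2 : ℝ)⁻¹ * (√2)⁻¹ = 1 / 2 := by
      rw [← mul_inv, Real.mul_self_sqrt (by norm_num)]; norm_num
    ext i j
    fin_cases i <;> fin_cases j <;>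
      simp [Matrix.mul_apply, Fin.sum_univ_three, neg_div] <;> nlinarith [h])

/-- The group generated by the translations `L_Λ` and `τ`. -/
def Γ₁ : Subgroup (E3 ≃ᵢ E3) := translations lattice ⊔ Subgroup.closure {τ}

/-- The group generated by the translations `L_Λ` and `ρ`. -/
def Γ₂ : Subgroup (E3 ≃ᵢ E3) := translations lattice ⊔ Subgroup.closure {ρ}

/-- The subgroup of `O(3)` generated by `τ`, `ρ` and `A`. -/
def H : Subgroup (E3 ≃ᵢ E3) := Subgroup.closure {τ, ρ, A}

/-- The group of isometries of the torus induced by `Γ₁`. -/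
def G₁ : Subgroup (Torus lattice' ≃ᵢ Torus lattice') := descend lattice' Γ₁

/-- The group of isometries of the torus induced by `Γ₂`. -/
def G₂ : Subgroup (Torus lattice' ≃ᵢ Torus lattice') := descend lattice' Γ₂

/-- The group of isometries of the torus induced by the group generated by `H` and the
translations by vectors in `Λ'/4`. -/
def G : Subgroup (Torus lattice' ≃ᵢ Torus lattice') :=
  descend lattice' (H ⊔ translations quarterLattice')

end FlatOrbifold

end

open FlatOrbifold

/-!
On `ℝⁿ` the operator `d d* + d* d` is minus the coefficientwise Laplacian, by Cartan's formula for
constant vector fields. Hence the coefficients of an eigenform on a flat torus are combinations of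
the finitely many characters of the lattice with the given eigenvalue, and the eigenspaces are
finite-dimensional. The eigenforms on `Γᵢ \ ℝ³` are the eigenforms on `T` which are invariant under
`Gᵢ`. The dimension of the space of invariants of a finite group is the average of the character of
the representation, which is constant on conjugacy classes, so almost conjugate groups have
invariants of equal dimension (Sunada's argument).

With respect to the basis `(1,1,0)`, `(1,-1,0)`, `(0,0,√2)` of `Λ'` the maps `τ`, `ρ` and `A` are
signed permutations, so `H` is finite and preserves `Λ'`. The map `A` conjugates `τ` to `ρ`, but
does not preserve `Λ`. For `l ∈ Λ` there is nevertheless `c ∈ Λ'/4` such that `L_c A` conjugates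
`τ L_l` to `ρ L_{σ l}`, where `σ` is an automorphism of `Λ` which preserves `Λ'`: the component of
`l` along the reversed directions can be corrected by `c`. Thus `L_l ↦ L_l`, `τ L_l ↦ ρ L_{σ l}`
induces a bijection `G₁ → G₂` which preserves conjugacy classes in `G`.

A point `x` is fixed by `κ L_l`, where `κ` is `τ` or `ρ`, if and only if `x - κ x = κ l`, so the
singular set is a union of lines parallel to the axis of the half-turn `κ`, and the images of these
lines in the quotient are the circles.
-/

noncomputable section

namespace FlatOrbifold

open EuclideanSpace (single)

section HodgeLaplacian

open ContinuousAlternatingMap InnerProductSpace Laplacian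

variable {E F : Type*} [NormedAddCommGroup E] [NormedSpace ℝ E] [NormedAddCommGroup F]
  [NormedSpace ℝ F] {n k : ℕ}

/-- The interior product `ι(e)` on alternating forms, as a continuous linear map. -/
def interiorProduct (e : E) : (E [⋀^Fin (k + 1)]→L[ℝ] F) →L[ℝ] E [⋀^Fin k]→L[ℝ] F :=
  (ContinuousLinearMap.apply ℝ _ e).comp (curryLeftLI (𝕜 := ℝ) (n := k)).toContinuousLinearMap

theorem interiorProduct_apply (e : E) (α : E [⋀^Fin (k + 1)]→L[ℝ] F) (v : Fin k → E) :
    interiorProduct e α v = α (Matrix.vecCons e v) := rfl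

theorem interiorProduct_alternatizeUncurryFin_zero (e : E) (f : E →L[ℝ] E [⋀^Fin 0]→L[ℝ] F) :
    interiorProduct e (alternatizeUncurryFin f) = f e := by
  ext v
  simp [interiorProduct_apply, alternatizeUncurryFin_apply, Subsingleton.elim _ v]

-- The constant-coefficient case of Cartan's formula `ι(e) d + d ι(e) = ∂_e`.
theorem interiorProduct_alternatizeUncurryFin (e : E) (f : E →L[ℝ] E [⋀^Fin (k + 1)]→L[ℝ] F) :
    interiorProduct e (alternatizeUncurryFin f) =
      f e - alternatizeUncurryFin ((interiorProduct e).comp f) := by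
  ext v
  have removeNth_succ (j : Fin (k + 1)) : j.succ.removeNth (Matrix.vecCons e v) =
      Matrix.vecCons e (j.removeNth v) := by
    funext l
    refine Fin.cases ?_ (fun l => ?_) l <;> simp [Fin.removeNth, Matrix.vecCons]
  simp [interiorProduct_apply, alternatizeUncurryFin_apply, Fin.sum_univ_succ (n := k + 1),
    removeNth_succ, pow_succ, sub_eq_add_neg]

theorem hasFDerivAt_fderiv {f : E → F} (hf : ContDiff ℝ 2 f) (x : E) :
    HasFDerivAt (fderiv ℝ f) (fderiv ℝ (fderiv ℝ f) x) x :=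
  ((hf.fderiv_right (m := 1) (by norm_num)).differentiable one_ne_zero x).hasFDerivAt

theorem fderiv_fderiv_apply {f : E → F} (hf : ContDiff ℝ 2 f) (u : E) :
    (fun x => fderiv ℝ (fderiv ℝ f) x u u) = fun x => fderiv ℝ (fun y => fderiv ℝ f y u) x u := by
  funext x
  rw [((hasFDerivAt_fderiv hf x).clm_apply (hasFDerivAt_const u x)).fderiv]
  simp

theorem hasDerivAt_comp_add_smul {f : E → F} (hf : ContDiff ℝ 1 f) (u x : E) (s : ℝ) :
    HasDerivAt (fun s : ℝ => f (x + s • u)) (fderiv ℝ f (x + s • u) u) s := by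
  have hline : HasDerivAt (fun s : ℝ => x + s • u) u s := by
    simpa using ((hasDerivAt_id s).smul_const u).const_add x
  exact (hf.differentiable one_ne_zero _).hasFDerivAt.comp_hasDerivAt s hline

theorem codiff_eq_neg_sum_interiorProduct (θ : Form n (k + 1)) :
    codiff θ = fun x => -∑ i, interiorProduct (single i 1) (fderiv ℝ θ x (single i 1)) := rfl

theorem codiff_extDeriv {θ : Form n k} (hθ : ContDiff ℝ 2 θ) (x : EuclideanSpace ℝ (Fin n)) :
    codiff (extDeriv θ) x = -∑ i, interiorProduct (single i 1)
      (alternatizeUncurryFin (fderiv ℝ (fderiv ℝ θ) x (single i 1))) := by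
  have hd : HasFDerivAt (extDeriv θ) ((alternatizeUncurryFinCLM ℝ _ ℝ).comp _) x :=
    (alternatizeUncurryFinCLM ℝ (EuclideanSpace ℝ (Fin n)) ℝ).hasFDerivAt.comp x
      (hasFDerivAt_fderiv hθ x)
  simp only [codiff_eq_neg_sum_interiorProduct, hd.fderiv]
  rfl

theorem extDeriv_codiff {θ : Form n (k + 1)} (hθ : ContDiff ℝ 2 θ)
    (x : EuclideanSpace ℝ (Fin n)) :
    extDeriv (codiff θ) x = -∑ i, alternatizeUncurryFin
      ((interiorProduct (single i 1)).comp (fderiv ℝ (fderiv ℝ θ) x (single i 1))) := by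
  have hsymm : IsSymmSndFDerivAt ℝ θ x := hθ.contDiffAt.isSymmSndFDerivAt (by simp)
  have hd : HasFDerivAt (codiff θ) (-∑ i, (interiorProduct (single i 1)).comp
      (fderiv ℝ (fderiv ℝ θ) x (single i 1))) x := by
    rw [codiff_eq_neg_sum_interiorProduct]
    refine HasFDerivAt.neg (HasFDerivAt.fun_sum fun i _ => ?_)
    refine ((interiorProduct (single i 1)).hasFDerivAt.comp x
      ((hasFDerivAt_fderiv hθ x).clm_apply (hasFDerivAt_const _ x))).congr_fderiv ?_
    ext u : 1
    simp [hsymm.eq u]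
  rw [extDeriv, hd.fderiv]
  change alternatizeUncurryFinCLM ℝ _ ℝ _ = _
  simp only [_root_.map_neg, _root_.map_sum]
  rfl

theorem formLaplacian_eq_neg_laplacian {θ : Form n k} (hθ : ContDiff ℝ 2 θ) :
    formLaplacian θ = -Δ θ := by
  funext x
  rw [laplacian_eq_iteratedFDeriv_orthonormalBasis θ (EuclideanSpace.basisFun (Fin n) ℝ)]
  cases k with
  | zero =>
    simp [formLaplacian, codiff_extDeriv hθ, interiorProduct_alternatizeUncurryFin_zero,
      iteratedFDeriv_two_apply]
  | succ k =>
    simp only [formLaplacian, Pi.add_apply, Pi.neg_apply, extDeriv_codiff hθ, codiff_extDeriv hθ,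
      interiorProduct_alternatizeUncurryFin, Finset.sum_sub_distrib, neg_sub,
      EuclideanSpace.basisFun_apply, iteratedFDeriv_two_apply, Fin.isValue, Matrix.cons_val_zero,
      Matrix.cons_val_one, Matrix.cons_val_fin_one]
    abel

end HodgeLaplacian

section Pullback

open InnerProductSpace Laplacian

variable {E F : Type*} [NormedAddCommGroup E] [NormedSpace ℝ E] [NormedAddCommGroup F]
  [NormedSpace ℝ F] {n k : ℕ}

/-- The linear part of an isometry of a real normed space, which is affine by the Mazur–Ulam
theorem. -/
def linearPart (γ : E ≃ᵢ E) : E ≃ₗᵢ[ℝ] E :=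
  γ.toRealAffineIsometryEquiv.linearIsometryEquiv

theorem apply_eq_linearPart_add (γ : E ≃ᵢ E) (x : E) : γ x = linearPart γ x + γ 0 := by
  simpa [linearPart] using γ.toRealAffineIsometryEquiv.map_vadd 0 x

theorem apply_add (γ : E ≃ᵢ E) (x l : E) : γ (x + l) = γ x + linearPart γ l := by
  rw [apply_eq_linearPart_add γ (x + l), apply_eq_linearPart_add γ x, map_add, add_right_comm]

theorem coe_eq_linearPart_add (γ : E ≃ᵢ E) : ⇑γ = fun x => linearPart γ x + γ 0 :=
  funext (apply_eq_linearPart_add γ)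

theorem hasFDerivAt_isometryEquiv (γ : E ≃ᵢ E) (x : E) :
    HasFDerivAt γ ((linearPart γ : E ≃L[ℝ] E) : E →L[ℝ] E) x := by
  rw [coe_eq_linearPart_add γ]
  exact (ContinuousLinearMap.hasFDerivAt _).add_const _

theorem contDiff_isometryEquiv (γ : E ≃ᵢ E) {m : WithTop ℕ∞} : ContDiff ℝ m γ := by
  rw [coe_eq_linearPart_add γ]
  exact (linearPart γ).contDiff.add contDiff_const

theorem laplacian_comp_isometryEquiv {V : Type*} [NormedAddCommGroup V] [InnerProductSpace ℝ V]
    [FiniteDimensional ℝ V] (γ : V ≃ᵢ V) {f : V → F} (hf : ContDiff ℝ 2 f) :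
    Δ (f ∘ γ) = Δ f ∘ γ := by
  have hcomp : f ∘ γ = (fun y => f (y + γ 0)) ∘ (linearPart γ : V ≃L[ℝ] V) :=
    funext fun x => congrArg f (apply_eq_linearPart_add γ x)
  have hshift : ContDiff ℝ 2 fun y => f (y + γ 0) := hf.comp (contDiff_id.add contDiff_const)
  have hbasis := laplacian_eq_iteratedFDeriv_orthonormalBasis f
    ((stdOrthonormalBasis ℝ V).map (linearPart γ))
  funext x
  rw [Function.comp_apply, hbasis, apply_eq_linearPart_add γ x, hcomp,
    laplacian_eq_iteratedFDeriv_stdOrthonormalBasis]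
  refine Finset.sum_congr rfl fun i _ => ?_
  rw [← ContinuousLinearEquiv.coe_coe,
    ContinuousLinearMap.iteratedFDeriv_comp_right _ hshift x le_rfl, iteratedFDeriv_comp_add_right]
  rw [ContinuousMultilinearMap.compContinuousLinearMap_apply]
  refine congrArg (iteratedFDeriv ℝ 2 f _) (funext fun j => ?_)
  fin_cases j <;> simp

/-- Pullback of alternating forms along the linear part of an isometry: the action of `pullback`
on values of differential forms. -/
def linearPullback (γ : E ≃ᵢ E) : (E [⋀^Fin k]→L[ℝ] F) →L[ℝ] E [⋀^Fin k]→L[ℝ] F :=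
  ContinuousAlternatingMap.compContinuousLinearMapCLM ((linearPart γ : E ≃L[ℝ] E) : E →L[ℝ] E)

variable (γ δ : EuclideanSpace ℝ (Fin n) ≃ᵢ EuclideanSpace ℝ (Fin n)) {θ : Form n k}

theorem pullback_eq_comp (θ : Form n k) : pullback γ θ = linearPullback γ ∘ θ ∘ γ := by
  funext x
  rw [pullback, (hasFDerivAt_isometryEquiv γ x).fderiv]
  rfl

theorem contDiff_pullback {m : WithTop ℕ∞} (hθ : ContDiff ℝ m θ) :
    ContDiff ℝ m (pullback γ θ) := by
  rw [pullback_eq_comp]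
  exact (linearPullback γ).contDiff.comp (hθ.comp (contDiff_isometryEquiv γ))

theorem pullback_one (θ : Form n k) : pullback 1 θ = θ := by
  funext x
  ext v
  rw [pullback, show fderiv ℝ ⇑(1 : EuclideanSpace ℝ (Fin n) ≃ᵢ _) x = .id ℝ _ from fderiv_id]
  rfl

theorem pullback_mul (θ : Form n k) : pullback (γ * δ) θ = pullback δ (pullback γ θ) := by
  funext x
  ext v
  have chain_rule : fderiv ℝ ⇑(γ * δ) x = (fderiv ℝ γ (δ x)).comp (fderiv ℝ δ x) :=
    fderiv_comp x (hasFDerivAt_isometryEquiv γ _).differentiableAt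
      (hasFDerivAt_isometryEquiv δ x).differentiableAt
  rw [pullback, chain_rule]
  rfl

theorem pullback_L (b : EuclideanSpace ℝ (Fin n)) (θ : Form n k) :
    pullback (L b) θ = fun x => θ (x + b) := by
  funext x
  ext v
  rw [pullback, show fderiv ℝ ⇑(L b) x = .id ℝ _ from ((hasFDerivAt_id x).add_const b).fderiv]
  rfl

theorem formLaplacian_pullback (hθ : ContDiff ℝ 2 θ) :
    formLaplacian (pullback γ θ) = pullback γ (formLaplacian θ) := by
  rw [formLaplacian_eq_neg_laplacian (contDiff_pullback γ hθ), formLaplacian_eq_neg_laplacian hθ,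
    pullback_eq_comp, pullback_eq_comp]
  funext x
  rw [Pi.neg_apply, ContDiffAt.laplacian_CLM_comp_left
    (hθ.comp (contDiff_isometryEquiv γ)).contDiffAt, laplacian_comp_isometryEquiv γ hθ]
  exact (map_neg (linearPullback γ) _).symm

end Pullback

section Fourier

open MeasureTheory InnerProductSpace Laplacian

variable {ι V : Type*} [NormedAddCommGroup V] [InnerProductSpace ℝ V]

/-- `g` is periodic with respect to the lattice spanned by the basis `b`. -/
def IsPeriodic {α : Type*} (b : Module.Basis ι ℝ V) (g : V → α) : Prop :=
  ∀ l ∈ Submodule.span ℤ (Set.range b), Function.Periodic g l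

theorem IsPeriodic.comp_add_right {α : Type*} {b : Module.Basis ι ℝ V} {g : V → α}
    (hg : IsPeriodic b g) (a : V) : IsPeriodic b fun x => g (x + a) := by
  intro l hl x
  simp only [add_right_comm x l a, hg l hl (x + a)]

theorem IsPeriodic.fderiv_apply {b : Module.Basis ι ℝ V} {g : V → ℂ} (hg : IsPeriodic b g) (u : V) :
    IsPeriodic b fun x => fderiv ℝ g x u := by
  intro l hl x
  have hshift : (fun y => g (y + l)) = g := funext (hg l hl)
  have hderiv := fderiv_comp_add_right (𝕜 := ℝ) (f := g) (x := x) l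
  rw [hshift] at hderiv
  exact (congrArg (fun f => f u) hderiv).symm

/-- The quotient map from `V` onto the standard torus `(ℝ / ℤ)^ι` whose kernel is the lattice
spanned by `b`. -/
def torusMap (b : Module.Basis ι ℝ V) : V →+ UnitAddTorus ι :=
  AddMonoidHom.pi fun i =>
    (QuotientAddGroup.mk' (AddSubgroup.zmultiples (1 : ℝ))).comp (b.coord i).toAddMonoidHom

theorem torusMap_apply (b : Module.Basis ι ℝ V) (x : V) (i : ι) :
    torusMap b x i = (b.repr x i : UnitAddCircle) := rfl

theorem torusMap_eq_zero_iff [Finite ι] {b : Module.Basis ι ℝ V} {x : V} :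
    torusMap b x = 0 ↔ x ∈ Submodule.span ℤ (Set.range b) := by
  rw [b.mem_span_iff_repr_mem ℤ, funext_iff]
  refine forall_congr' fun i => ?_
  rw [torusMap_apply, Pi.zero_apply, AddCircle.coe_eq_zero_iff]
  simp

theorem isOpenQuotientMap_torusMap [Finite ι] (b : Module.Basis ι ℝ V) :
    IsOpenQuotientMap (torusMap b) :=
  (IsOpenQuotientMap.piMap (f := fun (_ : ι) (t : ℝ) => (t : UnitAddCircle))
    fun _ => QuotientAddGroup.isOpenQuotientMap_mk).comp
      b.equivFunL.toHomeomorph.isOpenQuotientMap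

variable [Fintype ι]

/-- The function on the standard torus corresponding to a function on `V` which is periodic with
respect to `b`. To avoid carrying proofs of periodicity it is defined for every `g`, by means of a
section of `torusMap b`. -/
def torusLift {α : Type*} (b : Module.Basis ι ℝ V) (g : V → α) : UnitAddTorus ι → α :=
  g ∘ Function.surjInv (isOpenQuotientMap_torusMap b).surjective

theorem torusLift_torusMap {α : Type*} {b : Module.Basis ι ℝ V} {g : V → α}
    (hg : IsPeriodic b g) (x : V) : torusLift b g (torusMap b x) = g x := by
  have hmem : Function.surjInv (isOpenQuotientMap_torusMap b).surjective (torusMap b x) - x ∈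
      Submodule.span ℤ (Set.range b) := by
    rw [← torusMap_eq_zero_iff, map_sub, sub_eq_zero]
    exact Function.surjInv_eq _ _
  simpa [torusLift] using hg _ hmem x

theorem continuous_torusLift {α : Type*} [TopologicalSpace α] {b : Module.Basis ι ℝ V} {g : V → α}
    (hg : IsPeriodic b g) (hc : Continuous g) : Continuous (torusLift b g) := by
  rw [(isOpenQuotientMap_torusMap b).isQuotientMap.continuous_iff]
  exact hc.congr fun x => (torusLift_torusMap hg x).symm

/-- The linear form `x ↦ ∑ i, kᵢ xᵢ` in the coordinates given by `b`: an element of the dual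
lattice. -/
def frequency (b : Module.Basis ι ℝ V) (k : ι → ℤ) : StrongDual ℝ V :=
  ∑ i, (k i : ℝ) • (ContinuousLinearMap.proj i).comp (b.equivFunL : V →L[ℝ] ι → ℝ)

theorem frequency_apply (b : Module.Basis ι ℝ V) (k : ι → ℤ) (x : V) :
    frequency b k x = ∑ i, k i * b.repr x i := by
  simp [frequency]

theorem frequency_basis (b : Module.Basis ι ℝ V) (k : ι → ℤ) (i : ι) :
    frequency b k (b i) = k i := by
  classical
  simp [frequency_apply, Finsupp.single_apply]

theorem mFourier_torusMap (b : Module.Basis ι ℝ V) (k : ι → ℤ) (x : V) :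
    UnitAddTorus.mFourier k (torusMap b x) =
      Complex.exp (2 * Real.pi * Complex.I * frequency b k x) := by
  simp only [UnitAddTorus.mFourier, ContinuousMap.coe_mk, torusMap_apply, fourier_coe_apply,
    frequency_apply, Complex.ofReal_one, div_one, ← Complex.exp_sum]
  push_cast
  rw [Finset.mul_sum]
  exact congrArg _ (Finset.sum_congr rfl fun i _ => by ring)

theorem finite_setOf_norm_frequency_le (b : Module.Basis ι ℝ V) (R : ℝ) :
    {k : ι → ℤ | ‖frequency b k‖ ≤ R}.Finite := by
  refine (Set.Finite.pi' fun i => Set.finite_Icc (-⌈R * ‖b i‖⌉) ⌈R * ‖b i‖⌉).subset fun k hk i => ?_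
  have hki : |(k i : ℝ)| ≤ R * ‖b i‖ := by
    rw [← frequency_basis b k i, ← Real.norm_eq_abs]
    exact (frequency b k).le_of_opNorm_le hk (b i)
  rw [Set.mem_Icc, ← abs_le]
  exact_mod_cast hki.trans (Int.le_ceil _)

theorem norm_sq_eq_sum_sq_apply (e : OrthonormalBasis ι ℝ V) (ℓ : StrongDual ℝ V) :
    ‖ℓ‖ ^ 2 = ∑ i, ℓ (e i) ^ 2 := by
  have := e.toBasis.finiteDimensional_of_finite
  have := FiniteDimensional.complete ℝ V
  obtain ⟨v, rfl⟩ := (toDual ℝ V).surjective ℓ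
  simp [← e.sum_sq_norm_inner_left v]

/-- The Fourier coefficients of a periodic function. -/
def latticeFourierCoeff (b : Module.Basis ι ℝ V) (g : V → ℂ) (k : ι → ℤ) : ℂ :=
  UnitAddTorus.mFourierCoeff (torusLift b g) k

theorem latticeFourierCoeff_eq_integral (b : Module.Basis ι ℝ V) (g : V → ℂ) (k : ι → ℤ) :
    latticeFourierCoeff b g k = ∫ t, UnitAddTorus.mFourier (-k) t * torusLift b g t
      ∂Measure.pi fun _ : ι => AddCircle.haarAddCircle := rfl

variable {b : Module.Basis ι ℝ V} {g : V → ℂ}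

theorem integrable_mFourier_mul_torusLift (hg : IsPeriodic b g) (hc : Continuous g) (k : ι → ℤ) :
    Integrable (fun t => UnitAddTorus.mFourier k t * torusLift b g t)
      (Measure.pi fun _ : ι => AddCircle.haarAddCircle) :=
  ((UnitAddTorus.mFourier k).continuous.mul
    (continuous_torusLift hg hc)).integrable_of_hasCompactSupport (.of_compactSpace _)

theorem latticeFourierCoeff_const_smul (a : ℂ) (g : V → ℂ) (k : ι → ℤ) :
    latticeFourierCoeff b (a • g) k = a * latticeFourierCoeff b g k := by
  rw [latticeFourierCoeff_eq_integral, latticeFourierCoeff_eq_integral, ← integral_const_mul]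
  exact congrArg _ (funext fun t => mul_left_comm _ _ _)

theorem latticeFourierCoeff_sum {κ : Type*} (s : Finset κ) {f : κ → V → ℂ}
    (hf : ∀ j ∈ s, IsPeriodic b (f j)) (hc : ∀ j ∈ s, Continuous (f j)) (k : ι → ℤ) :
    latticeFourierCoeff b (fun x => ∑ j ∈ s, f j x) k = ∑ j ∈ s, latticeFourierCoeff b (f j) k := by
  simp only [latticeFourierCoeff_eq_integral]
  rw [← integral_finsetSum s fun j hj => integrable_mFourier_mul_torusLift (hf j hj) (hc j hj) (-k)]
  exact congrArg _ (funext fun t => Finset.mul_sum _ _ _)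

theorem torusLift_comp_add_right (hg : IsPeriodic b g) (a : V) (t : UnitAddTorus ι) :
    torusLift b (fun x => g (x + a)) t = torusLift b g (t + torusMap b a) := by
  obtain ⟨x, rfl⟩ := (isOpenQuotientMap_torusMap b).surjective t
  rw [torusLift_torusMap (hg.comp_add_right a), ← map_add, torusLift_torusMap hg]

theorem mFourier_apply_add (k : ι → ℤ) (t t' : UnitAddTorus ι) :
    UnitAddTorus.mFourier k (t + t') = UnitAddTorus.mFourier k t * UnitAddTorus.mFourier k t' := by
  simp [UnitAddTorus.mFourier, fourier_apply, AddCircle.toCircle_add, Finset.prod_mul_distrib]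

theorem latticeFourierCoeff_comp_add_right (hg : IsPeriodic b g) (a : V) (k : ι → ℤ) :
    latticeFourierCoeff b (fun x => g (x + a)) k =
      Complex.exp (2 * Real.pi * Complex.I * frequency b k a) * latticeFourierCoeff b g k := by
  have hshift : ∀ t, UnitAddTorus.mFourier (-k) t = UnitAddTorus.mFourier k (torusMap b a) *
      UnitAddTorus.mFourier (-k) (t + torusMap b a) := fun t => by
    rw [mFourier_apply_add, mul_left_comm, ← UnitAddTorus.mFourier_add, add_neg_cancel,
      UnitAddTorus.mFourier_zero, ContinuousMap.one_apply, mul_one]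
  rw [latticeFourierCoeff_eq_integral, latticeFourierCoeff_eq_integral, ← mFourier_torusMap,
    ← integral_const_mul, ← integral_add_right_eq_self (fun t => UnitAddTorus.mFourier k _ * _)
      (torusMap b a)]
  refine congrArg _ (funext fun t => ?_)
  rw [torusLift_comp_add_right hg, hshift t, mul_assoc]

theorem hasDerivAt_latticeFourierCoeff_comp_add_smul (hg : IsPeriodic b g) (hc : ContDiff ℝ 1 g)
    (u : V) (k : ι → ℤ) :
    HasDerivAt (fun s : ℝ => latticeFourierCoeff b (fun x => g (x + s • u)) k)
      (latticeFourierCoeff b (fun x => fderiv ℝ g x u) k) 0 := by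
  have hcont : Continuous fun x => fderiv ℝ g x u :=
    (hc.continuous_fderiv one_ne_zero).clm_apply continuous_const
  have hper := hg.fderiv_apply u
  obtain ⟨C, hC⟩ := (isCompact_range (continuous_torusLift hper hcont)).isBounded.exists_norm_le
  have hderiv := (hasDerivAt_integral_of_dominated_loc_of_deriv_le
    (μ := Measure.pi fun _ : ι => AddCircle.haarAddCircle) (x₀ := (0 : ℝ)) (bound := fun _ => C)
    (F := fun s t => UnitAddTorus.mFourier (-k) t * torusLift b (fun x => g (x + s • u)) t)
    (F' := fun s t => UnitAddTorus.mFourier (-k) t *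
      torusLift b (fun x => fderiv ℝ g (x + s • u) u) t) Filter.univ_mem
    (.of_forall fun s => (integrable_mFourier_mul_torusLift (hg.comp_add_right _)
      (hc.continuous.comp (continuous_add_const _)) (-k)).aestronglyMeasurable)
    (integrable_mFourier_mul_torusLift (hg.comp_add_right _)
      (hc.continuous.comp (continuous_add_const _)) (-k))
    (integrable_mFourier_mul_torusLift (hper.comp_add_right _)
      (hcont.comp (continuous_add_const _)) (-k)).aestronglyMeasurable
    (.of_forall fun t s _ => ?_) (integrable_const C) (.of_forall fun t s _ => ?_)).2
  · simpa only [zero_smul, add_zero, latticeFourierCoeff_eq_integral] using hderiv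
  · rw [norm_mul, torusLift_comp_add_right hper (s • u)]
    have hle : ‖UnitAddTorus.mFourier (-k) t‖ ≤ 1 :=
      ((UnitAddTorus.mFourier (-k)).norm_coe_le_norm t).trans_eq UnitAddTorus.mFourier_norm
    exact (mul_le_of_le_one_left (norm_nonneg _) hle).trans (hC _ (Set.mem_range_self _))
  · obtain ⟨x, rfl⟩ := (isOpenQuotientMap_torusMap b).surjective t
    simp only [torusLift_torusMap (hg.comp_add_right _), torusLift_torusMap (hper.comp_add_right _)]
    exact (hasDerivAt_comp_add_smul hc u x s).const_mul _

theorem latticeFourierCoeff_fderiv (hg : IsPeriodic b g) (hc : ContDiff ℝ 1 g) (u : V)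
    (k : ι → ℤ) : latticeFourierCoeff b (fun x => fderiv ℝ g x u) k =
      2 * Real.pi * Complex.I * frequency b k u * latticeFourierCoeff b g k := by
  have hexp : HasDerivAt
      (fun s : ℝ => Complex.exp (2 * Real.pi * Complex.I * frequency b k (s • u)))
      (2 * Real.pi * Complex.I * frequency b k u) 0 := by
    have hlin : HasDerivAt (fun s : ℝ => 2 * Real.pi * Complex.I * frequency b k (s • u))
        (2 * Real.pi * Complex.I * frequency b k u) 0 := by
      simpa [mul_comm, mul_assoc, mul_left_comm] using
        (Complex.ofRealCLM.hasDerivAt (x := (0 : ℝ))).const_mul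
          (2 * Real.pi * Complex.I * frequency b k u)
    simpa using hlin.cexp
  refine (hasDerivAt_latticeFourierCoeff_comp_add_smul hg hc u k).unique ?_
  simp only [latticeFourierCoeff_comp_add_right hg]
  exact hexp.mul_const _

theorem latticeFourierCoeff_fderiv_fderiv (hg : IsPeriodic b g) (hc : ContDiff ℝ 2 g) (u : V)
    (k : ι → ℤ) : latticeFourierCoeff b (fun x => fderiv ℝ (fderiv ℝ g) x u u) k =
      -(4 * Real.pi ^ 2 * frequency b k u ^ 2) * latticeFourierCoeff b g k := by
  rw [fderiv_fderiv_apply hc, latticeFourierCoeff_fderiv (hg.fderiv_apply u)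
    ((hc.fderiv_right (by norm_num)).clm_apply contDiff_const),
    latticeFourierCoeff_fderiv hg (hc.of_le one_le_two)]
  linear_combination (4 * Real.pi ^ 2 * frequency b k u ^ 2 * latticeFourierCoeff b g k) *
    Complex.I_sq

theorem latticeFourierCoeff_laplacian [FiniteDimensional ℝ V] (hg : IsPeriodic b g)
    (hc : ContDiff ℝ 2 g) (k : ι → ℤ) : latticeFourierCoeff b (Δ g) k =
      -(4 * Real.pi ^ 2 * ‖frequency b k‖ ^ 2) * latticeFourierCoeff b g k := by
  let e := stdOrthonormalBasis ℝ V
  have hΔ : Δ g = fun x => ∑ i, fderiv ℝ (fderiv ℝ g) x (e i) (e i) := by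
    funext x
    simp [laplacian_eq_iteratedFDeriv_orthonormalBasis g e, iteratedFDeriv_two_apply]
  rw [hΔ, latticeFourierCoeff_sum]
  · simp only [latticeFourierCoeff_fderiv_fderiv hg hc]
    rw [← Complex.ofReal_pow ‖_‖, norm_sq_eq_sum_sq_apply e]
    push_cast
    rw [← Finset.sum_mul, Finset.sum_neg_distrib, Finset.mul_sum]
  · exact fun i _ => fderiv_fderiv_apply hc (e i) ▸ (hg.fderiv_apply (e i)).fderiv_apply (e i)
  · exact fun i _ => (((hc.fderiv_right (m := 1) (by norm_num)).continuous_fderiv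
      one_ne_zero).clm_apply continuous_const).clm_apply continuous_const

theorem hasSum_latticeFourierCoeff (hg : IsPeriodic b g) (hc : Continuous g)
    (hs : Summable (latticeFourierCoeff b g)) (x : V) :
    HasSum (fun k => latticeFourierCoeff b g k *
      Complex.exp (2 * Real.pi * Complex.I * frequency b k x)) (g x) := by
  simpa [torusLift_torusMap hg, mFourier_torusMap, latticeFourierCoeff] using
    UnitAddTorus.hasSum_mFourier_series_apply_of_summable
      (f := ⟨torusLift b g, continuous_torusLift hg hc⟩) hs (torusMap b x)

/-- The space spanned by the characters of the lattice spanned by `b` which are eigenfunctions of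
`-Δ` with eigenvalue `c`. -/
def characterSpan (b : Module.Basis ι ℝ V) (c : ℝ) : Submodule ℂ (V → ℂ) :=
  Submodule.span ℂ ((fun k x => Complex.exp (2 * Real.pi * Complex.I * frequency b k x)) ''
    {k | 4 * Real.pi ^ 2 * ‖frequency b k‖ ^ 2 = c})

theorem finite_setOf_norm_frequency_sq_eq (b : Module.Basis ι ℝ V) (c : ℝ) :
    {k : ι → ℤ | 4 * Real.pi ^ 2 * ‖frequency b k‖ ^ 2 = c}.Finite := by
  refine (finite_setOf_norm_frequency_le b (√(c / (4 * Real.pi ^ 2)))).subset fun k hk => ?_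
  refine Real.le_sqrt_of_sq_le (le_of_eq ?_)
  rw [eq_div_iff (by positivity), mul_comm]
  exact hk

theorem mem_characterSpan_of_laplacian_eq [FiniteDimensional ℝ V] (hg : IsPeriodic b g)
    (hc : ContDiff ℝ 2 g) {c : ℝ} (h : Δ g = -(c : ℂ) • g) : g ∈ characterSpan b c := by
  have hzero : ∀ k, k ∉ (finite_setOf_norm_frequency_sq_eq b c).toFinset →
      latticeFourierCoeff b g k = 0 := by
    intro k hk
    have hk' : ((4 * Real.pi ^ 2 * ‖frequency b k‖ ^ 2 : ℝ) : ℂ) - c ≠ 0 := by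
      rw [sub_ne_zero]
      exact_mod_cast fun h => hk (by simpa using h)
    have hcoeff := latticeFourierCoeff_laplacian hg hc k
    rw [h, latticeFourierCoeff_const_smul] at hcoeff
    refine (mul_eq_zero.1 ?_).resolve_left hk'
    push_cast
    linear_combination hcoeff
  have hsum : g = ∑ k ∈ (finite_setOf_norm_frequency_sq_eq b c).toFinset,
      latticeFourierCoeff b g k •
        fun x => Complex.exp (2 * Real.pi * Complex.I * frequency b k x) := by
    funext x
    refine (hasSum_latticeFourierCoeff hg hc.continuous
      (summable_of_ne_finset_zero hzero) x).unique ?_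
    rw [Finset.sum_apply]
    exact hasSum_sum_of_ne_finset_zero fun k hk => by rw [hzero k hk, zero_mul]
  rw [hsum]
  exact Submodule.sum_mem _ fun k hk => Submodule.smul_mem _ _
    (Submodule.subset_span ⟨k, by simpa using hk, rfl⟩)

theorem finiteDimensional_characterSpan (b : Module.Basis ι ℝ V) (c : ℝ) :
    FiniteDimensional ℂ (characterSpan b c) :=
  FiniteDimensional.span_of_finite ℂ ((finite_setOf_norm_frequency_sq_eq b c).image _)

end Fourier

section FiniteDimensional

open InnerProductSpace Laplacian

variable {ι : Type*} {n k : ℕ} {b : Module.Basis ι ℝ (EuclideanSpace ℝ (Fin n))}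
  {Γ : Subgroup (EuclideanSpace ℝ (Fin n) ≃ᵢ EuclideanSpace ℝ (Fin n))} {c : ℝ}

/-- Evaluation of alternating forms on the coordinate directions `v`, with complex values so that
Fourier series apply. -/
def formCoeff (v : Fin k → Fin n) : (EuclideanSpace ℝ (Fin n) [⋀^Fin k]→L[ℝ] ℝ) →L[ℝ] ℂ :=
  Complex.ofRealCLM.comp
    (ContinuousAlternatingMap.apply ℝ _ ℝ fun j => EuclideanSpace.single (v j) (1 : ℝ))

theorem formCoeff_injective :
    Function.Injective fun (α : EuclideanSpace ℝ (Fin n) [⋀^Fin k]→L[ℝ] ℝ) v => formCoeff v α := by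
  intro α β h
  refine ContinuousAlternatingMap.toAlternatingMap_injective
    ((EuclideanSpace.basisFun (Fin n) ℝ).toBasis.ext_alternating fun v _ => ?_)
  simpa [formCoeff] using congrFun h v

theorem isPeriodic_of_forall_pullback
    (hΓ : translations (Submodule.span ℤ (Set.range b)).toAddSubgroup ≤ Γ) {θ : Form n k}
    (hθ : ∀ γ ∈ Γ, pullback γ θ = θ) : IsPeriodic b θ := by
  intro l hl x
  have h := hθ (L l) (hΓ ⟨l, hl, rfl⟩)
  rw [pullback_L] at h
  exact congrFun h x

theorem formCoeff_comp_mem_characterSpan [Fintype ι]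
    (hΓ : translations (Submodule.span ℤ (Set.range b)).toAddSubgroup ≤ Γ) {θ : Form n k}
    (hθ : θ ∈ eigenforms Γ k c) (v : Fin k → Fin n) : formCoeff v ∘ θ ∈ characterSpan b c := by
  obtain ⟨hsmooth, hinv, heig⟩ := hθ
  have hC2 : ContDiff ℝ 2 θ := contDiff_infty.1 hsmooth 2
  have hper : IsPeriodic b (formCoeff v ∘ θ) := fun l hl x =>
    congrArg (formCoeff v) (isPeriodic_of_forall_pullback hΓ hinv l hl x)
  refine mem_characterSpan_of_laplacian_eq hper ((formCoeff v).contDiff.comp hC2) ?_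
  funext x
  rw [formLaplacian_eq_neg_laplacian hC2, neg_eq_iff_eq_neg] at heig
  rw [hC2.contDiffAt.laplacian_CLM_comp_left, heig]
  simp

theorem finiteDimensional_eigenforms [Finite ι]
    (hΓ : translations (Submodule.span ℤ (Set.range b)).toAddSubgroup ≤ Γ) (k : ℕ) (c : ℝ) :
    FiniteDimensional ℝ (eigenforms Γ k c) := by
  have := Fintype.ofFinite ι
  have := finiteDimensional_characterSpan b c
  have : FiniteDimensional ℝ (characterSpan b c) := Module.Finite.trans ℂ _
  let coefficients : eigenforms Γ k c →ₗ[ℝ] (Fin k → Fin n) → characterSpan b c :=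
    { toFun := fun θ v => ⟨formCoeff v ∘ θ, formCoeff_comp_mem_characterSpan hΓ θ.2 v⟩
      map_add' := fun θ η => by ext v x; simp
      map_smul' := fun a θ => by ext v x; simp }
  refine FiniteDimensional.of_injective coefficients fun θ η h => Subtype.ext (funext fun x => ?_)
  refine formCoeff_injective (funext fun v => ?_)
  exact congrFun (congrArg Subtype.val (congrFun h v)) x

end FiniteDimensional

section TorusIsometries

variable {n : ℕ} {Λ Λ' : AddSubgroup (EuclideanSpace ℝ (Fin n))}
  {γ δ : EuclideanSpace ℝ (Fin n) ≃ᵢ EuclideanSpace ℝ (Fin n)}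
  {l x y : EuclideanSpace ℝ (Fin n)} {r : ℝ}

theorem L_apply (l x : EuclideanSpace ℝ (Fin n)) : L l x = x + l := rfl

theorem L_injective : Function.Injective (L (n := n)) := fun l l' h => by
  simpa [L_apply] using congrArg (fun γ : _ ≃ᵢ _ => γ 0) h

theorem L_mem_translations_iff : L l ∈ translations Λ ↔ l ∈ Λ :=
  ⟨fun ⟨_, hb, h⟩ => L_injective h ▸ hb, fun hl => ⟨l, hl, rfl⟩⟩

theorem translations_mono (h : Λ ≤ Λ') : translations Λ ≤ translations Λ' := by
  rintro _ ⟨l, hl, rfl⟩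
  exact L_mem_translations_iff.2 (h hl)

/-- The group of the isometries of `ℝⁿ` which normalize the group of translations by `Λ`, that is,
which descend to the torus `ℝⁿ / Λ`. -/
abbrev latticeNormalizer (Λ : AddSubgroup (EuclideanSpace ℝ (Fin n))) :
    Subgroup (EuclideanSpace ℝ (Fin n) ≃ᵢ EuclideanSpace ℝ (Fin n)) :=
  Subgroup.normalizer (translations Λ : Set (EuclideanSpace ℝ (Fin n) ≃ᵢ _))

theorem mul_L_mul_inv (γ : EuclideanSpace ℝ (Fin n) ≃ᵢ EuclideanSpace ℝ (Fin n))
    (l : EuclideanSpace ℝ (Fin n)) : γ * L l * γ⁻¹ = L (linearPart γ l) := by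
  ext1 x
  change γ (γ.symm x + l) = x + linearPart γ l
  rw [apply_add, γ.apply_symm_apply]

theorem mem_latticeNormalizer_iff :
    γ ∈ latticeNormalizer Λ ↔
      ∀ l, l ∈ Λ ↔ linearPart γ l ∈ Λ := by
  rw [Subgroup.mem_normalizer_iff]
  refine ⟨fun h l => ?_, fun h δ => ⟨?_, ?_⟩⟩
  · rw [← L_mem_translations_iff, h, mul_L_mul_inv, L_mem_translations_iff]
  · rintro ⟨l, hl, rfl⟩
    rw [mul_L_mul_inv, L_mem_translations_iff]
    exact (h l).1 hl
  · rintro ⟨l, hl, hδ⟩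
    obtain ⟨l, rfl⟩ := (linearPart γ).surjective l
    rw [← mul_L_mul_inv, mul_left_inj, mul_right_inj] at hδ
    exact hδ ▸ L_mem_translations_iff.2 ((h l).2 hl)

theorem linearPart_L (l l' : EuclideanSpace ℝ (Fin n)) : linearPart (L l) l' = l' := by
  simpa [L_apply, add_comm l'] using (apply_add (L l) 0 l').symm

theorem L_mem_latticeNormalizer (l : EuclideanSpace ℝ (Fin n)) :
    L l ∈ latticeNormalizer Λ := by
  refine mem_latticeNormalizer_iff.2 fun l' => ?_
  rw [linearPart_L]

theorem mk_apply_eq_mk_apply_iff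
    (hγ : γ ∈ latticeNormalizer Λ) :
    (γ x : Torus Λ) = γ y ↔ (x : Torus Λ) = y := by
  rw [QuotientAddGroup.eq, QuotientAddGroup.eq, mem_latticeNormalizer_iff.1 hγ (-x + y),
    map_add, map_neg, apply_eq_linearPart_add γ x, apply_eq_linearPart_add γ y, neg_add,
    add_add_add_comm, add_comm (-linearPart γ x), add_comm (-γ 0), add_assoc]
  simp

theorem dist_mk_lt_iff : dist (x : Torus Λ) y < r ↔ ∃ l ∈ Λ, dist x (y + l) < r := by
  rw [dist_eq_norm, ← QuotientAddGroup.mk_sub, QuotientAddGroup.norm_lt_iff]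
  constructor
  · rintro ⟨m, hm, h⟩
    refine ⟨x - y - m, by simpa [neg_add_eq_sub] using QuotientAddGroup.eq.1 hm, ?_⟩
    rwa [dist_eq_norm, add_sub_assoc', add_sub_cancel, sub_sub_cancel]
  · rintro ⟨l, hl, h⟩
    refine ⟨x - y - l, QuotientAddGroup.eq.2 (by simpa using hl), ?_⟩
    rwa [sub_sub, ← dist_eq_norm]

theorem dist_mk_le (x y : EuclideanSpace ℝ (Fin n)) : dist (x : Torus Λ) y ≤ dist x y :=
  le_of_forall_gt fun _ hr => dist_mk_lt_iff.2 ⟨0, Λ.zero_mem, by rwa [add_zero]⟩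

theorem dist_mk_apply_le
    (hγ : γ ∈ latticeNormalizer Λ)
    (x y : EuclideanSpace ℝ (Fin n)) : dist (γ x : Torus Λ) (γ y) ≤ dist (x : Torus Λ) y := by
  refine le_of_forall_gt fun r hr => ?_
  obtain ⟨l, hl, h⟩ := dist_mk_lt_iff.1 hr
  refine dist_mk_lt_iff.2 ⟨linearPart γ l, (mem_latticeNormalizer_iff.1 hγ l).1 hl, ?_⟩
  rwa [← apply_add, γ.dist_eq]

/-- The isometry of the torus induced by an isometry of `ℝⁿ` which normalizes the group of
lattice translations. -/
def induced (γ : latticeNormalizer Λ) : Torus Λ ≃ᵢ Torus Λ where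
  toFun := Quotient.map' γ.1 fun _ _ h =>
    Quotient.exact' ((mk_apply_eq_mk_apply_iff γ.2).2 (Quotient.sound' h))
  invFun := Quotient.map' γ⁻¹.1 fun _ _ h =>
    Quotient.exact' ((mk_apply_eq_mk_apply_iff γ⁻¹.2).2 (Quotient.sound' h))
  left_inv := by
    rintro ⟨x⟩
    exact congrArg (QuotientAddGroup.mk (s := Λ)) (γ.1.symm_apply_apply x)
  right_inv := by
    rintro ⟨x⟩
    exact congrArg (QuotientAddGroup.mk (s := Λ)) (γ.1.apply_symm_apply x)
  isometry_toFun := by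
    refine Isometry.of_dist_eq ?_
    rintro ⟨x⟩ ⟨y⟩
    refine le_antisymm (dist_mk_apply_le γ.2 x y) ?_
    have h := dist_mk_apply_le γ⁻¹.2 (γ.1 x) (γ.1 y)
    have hinv : ∀ z, (γ⁻¹).1 (γ.1 z) = z := γ.1.symm_apply_apply
    rwa [hinv, hinv] at h

theorem exists_isInducedBy (hγ : γ ∈ latticeNormalizer Λ) : ∃ f, IsInducedBy Λ f γ :=
  ⟨induced ⟨γ, hγ⟩, fun _ => rfl⟩

theorem IsInducedBy.eq {f g : Torus Λ ≃ᵢ Torus Λ} (hf : IsInducedBy Λ f γ)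
    (hg : IsInducedBy Λ g γ) : f = g := by
  ext t
  induction t using QuotientAddGroup.induction_on with
  | H x => rw [hf, hg]

theorem isInducedBy_one_iff [DiscreteTopology Λ] :
    IsInducedBy Λ 1 γ ↔ γ ∈ translations Λ := by
  constructor
  · intro h
    have hmem (x) : γ x - x ∈ Λ := by
      rw [sub_eq_neg_add]
      exact QuotientAddGroup.eq.1 (h x)
    have continuous_sub : Continuous fun x => (⟨γ x - x, hmem x⟩ : Λ) :=
      (γ.continuous.sub continuous_id).subtype_mk hmem
    refine ⟨γ 0 - 0, hmem 0, ?_⟩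
    ext1 x
    have hconst : γ 0 - 0 = γ x - x :=
      congrArg Subtype.val (PreconnectedSpace.constant inferInstance continuous_sub)
    rw [hconst, L_apply, add_sub_cancel]
  · rintro ⟨l, hl, rfl⟩ x
    exact QuotientAddGroup.eq.2 (by rwa [L_apply, neg_add_cancel_left])

end TorusIsometries

section OrbitSpaces

variable {X : Type*} [PseudoMetricSpace X]

theorem proj_eq_proj_iff {Γ : Subgroup (X ≃ᵢ X)} {x y : X} :
    proj Γ x = proj Γ y ↔ ∃ γ ∈ Γ, γ y = x := by
  rw [proj, proj, Quotient.eq, MulAction.orbitRel_apply, MulAction.mem_orbit_iff]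
  exact ⟨fun ⟨γ, h⟩ => ⟨γ, γ.2, h⟩, fun ⟨γ, hγ, h⟩ => ⟨⟨γ, hγ⟩, h⟩⟩

theorem continuous_proj (Γ : Subgroup (X ≃ᵢ X)) : Continuous (proj Γ) :=
  continuous_quotient_mk'

instance continuousConstSMul_isometrySubgroup (Γ : Subgroup (X ≃ᵢ X)) :
    ContinuousConstSMul Γ X := ⟨fun γ => γ.1.continuous⟩

variable {n : ℕ} {Λ : AddSubgroup (EuclideanSpace ℝ (Fin n))}
  {Γ : Subgroup (EuclideanSpace ℝ (Fin n) ≃ᵢ EuclideanSpace ℝ (Fin n))}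

theorem proj_mk_eq_iff (hΛ : translations Λ ≤ Γ)
    (hΓ : Γ ≤ latticeNormalizer Λ)
    {x y : EuclideanSpace ℝ (Fin n)} :
    proj (descend Λ Γ) (x : Torus Λ) = proj (descend Λ Γ) (y : Torus Λ) ↔
      proj Γ x = proj Γ y := by
  rw [proj_eq_proj_iff, proj_eq_proj_iff]
  constructor
  · rintro ⟨f, ⟨γ, hγ, hf⟩, h⟩
    rw [hf, QuotientAddGroup.eq] at h
    refine ⟨L (-γ y + x) * γ, Γ.mul_mem (hΛ ⟨_, h, rfl⟩) hγ, ?_⟩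
    exact add_neg_cancel_left (γ y) x
  · rintro ⟨γ, hγ, rfl⟩
    obtain ⟨f, hf⟩ := exists_isInducedBy (hΓ hγ)
    exact ⟨f, ⟨γ, hγ, hf⟩, hf y⟩

/-- The homeomorphism from `Γ \ ℝⁿ` to the quotient of the torus by the induced group. -/
def orbitSpaceHomeomorph (hΛ : translations Λ ≤ Γ)
    (hΓ : Γ ≤ latticeNormalizer Λ) :
    OrbitSpace Γ ≃ₜ OrbitSpace (descend Λ Γ) where
  toFun := Quotient.lift (fun x => proj (descend Λ Γ) (x : Torus Λ)) fun _ _ h =>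
    (proj_mk_eq_iff hΛ hΓ).2 (Quotient.sound h)
  invFun := Quotient.lift (Quotient.lift (proj Γ) fun _ _ h =>
      (proj_mk_eq_iff hΛ hΓ).1 (congrArg (proj (descend Λ Γ)) (Quotient.sound h))) (by
    rintro ⟨x⟩ ⟨y⟩ h
    exact (proj_mk_eq_iff hΛ hΓ).1 (Quotient.sound h))
  left_inv := by rintro ⟨x⟩; rfl
  right_inv := by rintro ⟨⟨x⟩⟩; rfl
  continuous_toFun := Continuous.quotient_lift
    ((continuous_proj _).comp continuous_quotient_mk') _
  continuous_invFun := Continuous.quotient_lift (Continuous.quotient_lift (continuous_proj _) _) _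

theorem exists_pos_forall_norm_lt_imp_eq_zero (Λ : AddSubgroup (EuclideanSpace ℝ (Fin n)))
    [DiscreteTopology Λ] : ∃ r > 0, ∀ l ∈ Λ, ‖l‖ < r → l = 0 := by
  obtain ⟨r, hr, h⟩ := Metric.isOpen_singleton_iff.1 (isOpen_discrete ({0} : Set Λ))
  exact ⟨r, hr, fun l hl hlr => congrArg Subtype.val
    (h ⟨l, hl⟩ (by rwa [Subtype.dist_eq, AddSubgroup.coe_zero, dist_zero_right]))⟩

theorem dist_mk_eq {r : ℝ} (hr : ∀ l ∈ Λ, ‖l‖ < r → l = 0) {x y : EuclideanSpace ℝ (Fin n)}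
    (hxy : dist x y < r / 2) : dist (x : Torus Λ) y = dist x y := by
  refine (dist_mk_le x y).antisymm (not_lt.1 fun hlt => ?_)
  obtain ⟨l, hl, h⟩ := dist_mk_lt_iff.1 hlt
  have hnorm : ‖l‖ < r := by
    have := dist_triangle_left y (y + l) x
    rw [dist_self_add_right] at this
    linarith
  rw [hr l hl hnorm, add_zero] at h
  exact h.false

/-- The quotient map to the torus on a ball small enough to be mapped isometrically. -/
def ballIsometry {r : ℝ} (hr : ∀ l ∈ Λ, ‖l‖ < r → l = 0) (x : EuclideanSpace ℝ (Fin n)) :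
    Metric.ball x (r / 4) ≃ᵢ Metric.ball (x : Torus Λ) (r / 4) :=
  have isometry_mk : Isometry fun z : Metric.ball x (r / 4) =>
      (⟨(z : EuclideanSpace ℝ (Fin n)), (dist_mk_le _ _).trans_lt z.2⟩ :
        Metric.ball (x : Torus Λ) (r / 4)) := Isometry.of_dist_eq fun z w =>
    dist_mk_eq hr (by linarith [dist_triangle_right (z : EuclideanSpace ℝ (Fin n)) w x,
      Metric.mem_ball.1 z.2, Metric.mem_ball.1 w.2])
  ⟨Equiv.ofBijective _ ⟨isometry_mk.injective, by
    rintro ⟨⟨y⟩, hy⟩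
    obtain ⟨l, hl, h⟩ := dist_mk_lt_iff.1 (Metric.mem_ball'.1 hy)
    exact ⟨⟨y + l, Metric.mem_ball'.2 h⟩, Subtype.ext (QuotientAddGroup.mk_add_of_mem y hl)⟩⟩,
    isometry_mk⟩

theorem orbifoldIsometric_descend [DiscreteTopology Λ] (hΛ : translations Λ ≤ Γ)
    (hΓ : Γ ≤ latticeNormalizer Λ) :
    OrbifoldIsometric Γ (descend Λ Γ) := by
  obtain ⟨r, hpos, hr⟩ := exists_pos_forall_norm_lt_imp_eq_zero Λ
  exact ⟨orbitSpaceHomeomorph hΛ hΓ, fun x => ⟨x, rfl, r / 4, by positivity, ballIsometry hr x,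
    fun z hz => congrArg (QuotientAddGroup.mk (s := Λ)) hz, fun z => rfl⟩⟩

end OrbitSpaces

section AlmostConjugate

variable {G' : Type*} [Group G'] {K₁ K₂ : Subgroup G'}

theorem exists_equiv_of_surjective {α β β' : Type*} {f : α → β} {f' : α → β'}
    (hf : Function.Surjective f) (hf' : Function.Surjective f')
    (h : ∀ a b, f a = f b ↔ f' a = f' b) : ∃ e : β ≃ β', ∀ a, e (f a) = f' a := by
  refine ⟨(Setoid.quotientKerEquivOfSurjective f hf).symm.trans
    ((Quotient.congrRight h).trans (Setoid.quotientKerEquivOfSurjective f' hf')), fun a => ?_⟩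
  have hsymm : (Setoid.quotientKerEquivOfSurjective f hf).symm (f a) = Quotient.mk _ a :=
    (Equiv.symm_apply_eq _).2 rfl
  rw [Equiv.trans_apply, hsymm]
  rfl

theorem ncard_conjugatesOf_inter (g : G') (K : Subgroup G') :
    (conjugatesOf g ∩ (K : Set G')).ncard =
      Nat.card {k : K // ConjClasses.mk (k : G') = ConjClasses.mk g} := by
  rw [← Nat.card_coe_set_eq]
  exact Nat.card_congr
    { toFun := fun x => ⟨⟨x, x.2.2⟩, ConjClasses.mk_eq_mk_iff_isConj.2 (IsConj.symm x.2.1)⟩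
      invFun := fun k => ⟨k, (ConjClasses.mk_eq_mk_iff_isConj.1 k.2).symm, k.1.2⟩
      left_inv := fun _ => rfl
      right_inv := fun _ => rfl }

theorem almostConjugate_iff_exists_equiv :
    AlmostConjugate K₁ K₂ ↔ Finite K₁ ∧ ∃ e : K₁ ≃ K₂, ∀ k : K₁, IsConj (k : G') (e k) := by
  simp only [AlmostConjugate, ncard_conjugatesOf_inter]
  constructor
  · rintro ⟨h₁, h₂, h⟩
    have fiber_card (c : ConjClasses G') :
        Nat.card {k : K₁ // ConjClasses.mk (k : G') = c} =
          Nat.card {k : K₂ // ConjClasses.mk (k : G') = c} := by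
      obtain ⟨g, rfl⟩ := ConjClasses.mk_surjective c
      exact h g
    let fiberEquiv (c : ConjClasses G') := Classical.choice (Finite.card_eq.1 (fiber_card c))
    exact ⟨h₁, Equiv.ofFiberEquiv fiberEquiv, fun k =>
      ConjClasses.mk_eq_mk_iff_isConj.1 (Equiv.ofFiberEquiv_map fiberEquiv k).symm⟩
  · rintro ⟨h₁, e, he⟩
    refine ⟨h₁, .of_equiv _ e, fun g => Nat.card_congr (e.subtypeEquiv fun k => ?_)⟩
    rw [ConjClasses.mk_eq_mk_iff_isConj.2 (he k)]

theorem almostConjugate_of_surjective [Finite K₁] {α : Type*} {s₁ : α → K₁} {s₂ : α → K₂}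
    (hs₁ : Function.Surjective s₁) (hs₂ : Function.Surjective s₂)
    (h : ∀ a b, s₁ a = s₁ b ↔ s₂ a = s₂ b) (hconj : ∀ a, IsConj (s₁ a : G') (s₂ a)) :
    AlmostConjugate K₁ K₂ := by
  obtain ⟨e, he⟩ := exists_equiv_of_surjective hs₁ hs₂ h
  refine almostConjugate_iff_exists_equiv.2 ⟨inferInstance, e, hs₁.forall.2 fun a => ?_⟩
  rw [he]
  exact hconj a

variable {𝕜 V : Type*}

/-- The space of the vectors of a representation which are fixed by a subgroup. -/
def fixedVectors [CommRing 𝕜] [AddCommGroup V] [Module 𝕜 V]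
    (R : Representation 𝕜 G' V) (K : Subgroup G') : Submodule 𝕜 V :=
  Representation.invariants (R.comp K.subtype)

theorem finrank_fixedVectors_eq_of_almostConjugate [Field 𝕜] [CharZero 𝕜]
    [AddCommGroup V] [Module 𝕜 V] [FiniteDimensional 𝕜 V]
    (R : Representation 𝕜 G' V) (h : AlmostConjugate K₁ K₂) :
    Module.finrank 𝕜 (fixedVectors R K₁) = Module.finrank 𝕜 (fixedVectors R K₂) := by
  obtain ⟨_, e, he⟩ := almostConjugate_iff_exists_equiv.1 h
  have := Fintype.ofFinite K₁
  have := Fintype.ofEquiv _ e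
  have card_ne_zero (K : Subgroup G') [Finite K] : (Nat.card K : 𝕜) ≠ 0 :=
    Nat.cast_ne_zero.2 Nat.card_pos.ne'
  have := invertibleOfNonzero (card_ne_zero K₁)
  have := invertibleOfNonzero (card_ne_zero K₂)
  rw [fixedVectors, fixedVectors, ← Nat.cast_inj (R := 𝕜),
    ← Representation.card_inv_mul_sum_char_eq_finrank,
    ← Representation.card_inv_mul_sum_char_eq_finrank, Nat.card_congr e, ← e.sum_comp]
  congr 1
  refine Finset.sum_congr rfl fun k _ => ?_
  obtain ⟨g, hg⟩ := isConj_iff.1 (he k)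
  exact (R.char_conj k g).symm.trans (congrArg R.character hg)

end AlmostConjugate

section Sunada

variable {n k : ℕ} {c : ℝ} {Λ : AddSubgroup (EuclideanSpace ℝ (Fin n))}
  {Γ Γ' : Subgroup (EuclideanSpace ℝ (Fin n) ≃ᵢ EuclideanSpace ℝ (Fin n))}

/-- The homomorphism sending an isometry of `ℝⁿ` in `Γ` to the induced isometry of the torus. -/
def descendHom (hΓ : Γ ≤ latticeNormalizer Λ) : Γ →* descend Λ Γ where
  toFun γ := ⟨induced ⟨γ, hΓ γ.2⟩, γ, γ.2, fun _ => rfl⟩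
  map_one' := Subtype.ext (IsInducedBy.eq (γ := 1) (fun _ => rfl) fun _ => rfl)
  map_mul' γ δ := Subtype.ext (IsInducedBy.eq (γ := γ * δ) (fun _ => rfl) fun _ => rfl)

theorem isInducedBy_descendHom (hΓ : Γ ≤ latticeNormalizer Λ) (γ : Γ) :
    IsInducedBy Λ (descendHom hΓ γ) γ := fun _ => rfl

theorem surjective_descendHom (hΓ : Γ ≤ latticeNormalizer Λ) :
    Function.Surjective (descendHom hΓ) := fun ⟨_, γ, hγ, hf⟩ =>
  ⟨⟨γ, hγ⟩, Subtype.ext ((isInducedBy_descendHom hΓ ⟨γ, hγ⟩).eq hf)⟩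

theorem mem_ker_descendHom_iff [DiscreteTopology Λ] (hΓ : Γ ≤ latticeNormalizer Λ) {γ : Γ} :
    γ ∈ (descendHom hΓ).ker ↔ (γ : EuclideanSpace ℝ (Fin n) ≃ᵢ _) ∈ translations Λ := by
  rw [MonoidHom.mem_ker, ← isInducedBy_one_iff]
  refine ⟨fun h => ?_, fun h => Subtype.ext ((isInducedBy_descendHom hΓ γ).eq h)⟩
  have := isInducedBy_descendHom hΓ γ
  rwa [h] at this

theorem descendHom_eq_descendHom_iff [DiscreteTopology Λ] (hΓ : Γ ≤ latticeNormalizer Λ)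
    {γ δ : Γ} : descendHom hΓ γ = descendHom hΓ δ ↔
      ∃ l ∈ Λ, (γ : EuclideanSpace ℝ (Fin n) ≃ᵢ EuclideanSpace ℝ (Fin n)) = δ * L l := by
  rw [MonoidHom.eq_iff, mem_ker_descendHom_iff]
  exact exists_congr fun l => and_congr_right fun _ => inv_mul_eq_iff_eq_mul

theorem descend_mono (h : Γ' ≤ Γ) : descend Λ Γ' ≤ descend Λ Γ := fun _ ⟨γ, hγ, hf⟩ =>
  ⟨γ, h hγ, hf⟩

theorem descend_subgroupOf (hΓ : Γ ≤ latticeNormalizer Λ) (hΓ' : Γ' ≤ Γ) :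
    (descend Λ Γ').subgroupOf (descend Λ Γ) = (Γ'.subgroupOf Γ).map (descendHom hΓ) := by
  ext f
  constructor
  · rintro ⟨γ, hγ, hf⟩
    exact ⟨⟨γ, hΓ' hγ⟩, hγ, Subtype.ext ((isInducedBy_descendHom hΓ _).eq hf)⟩
  · rintro ⟨γ, hγ, rfl⟩
    exact ⟨γ, hγ, isInducedBy_descendHom hΓ γ⟩

theorem almostConjugate_descend [DiscreteTopology Λ] [Finite (descend Λ Γ)]
    {Γ₁ Γ₂ : Subgroup (EuclideanSpace ℝ (Fin n) ≃ᵢ EuclideanSpace ℝ (Fin n))}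
    (hΓ : Γ ≤ latticeNormalizer Λ) (hΓ₁ : Γ₁ ≤ Γ) (hΓ₂ : Γ₂ ≤ Γ) {α : Type*}
    {s₁ : α → Γ₁} {s₂ : α → Γ₂} (hs₁ : Function.Surjective s₁) (hs₂ : Function.Surjective s₂)
    (h : ∀ a b, (∃ l ∈ Λ, (s₁ a : EuclideanSpace ℝ (Fin n) ≃ᵢ EuclideanSpace ℝ (Fin n)) =
      s₁ b * L l) ↔ ∃ l ∈ Λ, (s₂ a : EuclideanSpace ℝ (Fin n) ≃ᵢ EuclideanSpace ℝ (Fin n)) =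
      s₂ b * L l)
    (hconj : ∀ a, ∃ δ ∈ Γ, δ * s₁ a = s₂ a * δ) :
    AlmostConjugate ((descend Λ Γ₁).subgroupOf (descend Λ Γ))
      ((descend Λ Γ₂).subgroupOf (descend Λ Γ)) := by
  rw [descend_subgroupOf hΓ hΓ₁, descend_subgroupOf hΓ hΓ₂]
  let π {Γ' : Subgroup (EuclideanSpace ℝ (Fin n) ≃ᵢ EuclideanSpace ℝ (Fin n))} (hΓ' : Γ' ≤ Γ) :
      Γ' →* (Γ'.subgroupOf Γ).map (descendHom hΓ) :=
    ((descendHom hΓ).subgroupMap (Γ'.subgroupOf Γ)).comp (Subgroup.subgroupOfEquivOfLe hΓ').symm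
  have surjective_π {Γ'} (hΓ' : Γ' ≤ Γ) : Function.Surjective (π hΓ') :=
    ((descendHom hΓ).subgroupMap_surjective _).comp
      (Subgroup.subgroupOfEquivOfLe hΓ').symm.surjective
  have π_eq_π_iff {Γ'} (hΓ' : Γ' ≤ Γ) (γ δ : Γ') : π hΓ' γ = π hΓ' δ ↔ ∃ l ∈ Λ,
      (γ : EuclideanSpace ℝ (Fin n) ≃ᵢ EuclideanSpace ℝ (Fin n)) = δ * L l :=
    Subtype.ext_iff.trans (descendHom_eq_descendHom_iff hΓ)
  refine almostConjugate_of_surjective ((surjective_π hΓ₁).comp hs₁) ((surjective_π hΓ₂).comp hs₂)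
    (fun a b => (π_eq_π_iff hΓ₁ _ _).trans ((h a b).trans (π_eq_π_iff hΓ₂ _ _).symm)) fun a => ?_
  obtain ⟨δ, hδ, h⟩ := hconj a
  refine isConj_iff.2 ⟨descendHom hΓ ⟨δ, hδ⟩, mul_inv_eq_of_eq_mul ?_⟩
  exact ((descendHom hΓ).map_mul _ _).symm.trans
    ((congrArg (descendHom hΓ) (Subtype.ext h)).trans ((descendHom hΓ).map_mul _ _))

/-- The representation of `Γ` on the eigenforms of the torus by pullback along inverses. -/
def pullbackRep (hΓ : Γ ≤ latticeNormalizer Λ) (k : ℕ) (c : ℝ) :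
    Representation ℝ Γ (eigenforms (translations Λ) k c) where
  toFun γ :=
    { toFun := fun θ => ⟨pullback (γ⁻¹).1 θ, contDiff_pullback _ θ.2.1, fun t ht => by
          obtain ⟨l, hl, rfl⟩ := ht
          have hl' := (mem_latticeNormalizer_iff.1 (hΓ γ⁻¹.2) l).1 hl
          rw [← pullback_mul, ← inv_mul_cancel_right ((γ⁻¹).1 * L l) (γ⁻¹).1, mul_L_mul_inv,
            pullback_mul, θ.2.2.1 _ (L_mem_translations_iff.2 hl')], by
          rw [formLaplacian_pullback _ (θ.2.1.of_le (WithTop.coe_le_coe.2 le_top)), θ.2.2.2]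
          rfl⟩
      map_add' := fun _ _ => rfl
      map_smul' := fun _ _ => rfl }
  map_one' := by
    ext1 θ
    exact Subtype.ext ((congrArg (pullback · θ.1) inv_one).trans (pullback_one _))
  map_mul' γ δ := by
    ext1 θ
    exact Subtype.ext ((congrArg (pullback · θ.1) (mul_inv_rev γ.1 δ.1)).trans (pullback_mul _ _ _))

theorem ker_descendHom_le_ker_pullbackRep [DiscreteTopology Λ] (hΓ : Γ ≤ latticeNormalizer Λ)
    (k : ℕ) (c : ℝ) : (descendHom hΓ).ker ≤ (pullbackRep hΓ k c).ker := fun γ hγ => by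
  ext1 θ
  exact Subtype.ext (θ.2.2.1 _ ((mem_ker_descendHom_iff hΓ).1 (inv_mem hγ)))

/-- The representation of a group of isometries of the torus on the eigenforms of the torus. -/
def descendRep [DiscreteTopology Λ] (hΓ : Γ ≤ latticeNormalizer Λ) (k : ℕ) (c : ℝ) :
    Representation ℝ (descend Λ Γ) (eigenforms (translations Λ) k c) :=
  (QuotientGroup.lift _ (pullbackRep hΓ k c) (ker_descendHom_le_ker_pullbackRep hΓ k c)).comp
    (QuotientGroup.quotientKerEquivOfSurjective _ (surjective_descendHom hΓ)).symm

theorem descendRep_descendHom [DiscreteTopology Λ] (hΓ : Γ ≤ latticeNormalizer Λ) (γ : Γ)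
    (θ : eigenforms (translations Λ) k c) :
    (descendRep hΓ k c (descendHom hΓ γ) θ : Form n k) = pullback (γ⁻¹).1 θ := by
  have hγ : (QuotientGroup.quotientKerEquivOfSurjective _ (surjective_descendHom hΓ)).symm
      (descendHom hΓ γ) = γ := (MulEquiv.symm_apply_eq _).2 rfl
  simp only [descendRep, MonoidHom.comp_apply, MonoidHom.coe_coe, hγ]
  rfl

theorem mem_fixedVectors_descendRep_iff [DiscreteTopology Λ] (hΓ : Γ ≤ latticeNormalizer Λ)
    (hΓ' : Γ' ≤ Γ) {θ : eigenforms (translations Λ) k c} :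
    θ ∈ fixedVectors (V := eigenforms (translations Λ) k c) (descendRep hΓ k c)
        ((descend Λ Γ').subgroupOf (descend Λ Γ)) ↔
      ∀ γ ∈ Γ', pullback γ θ = (θ : Form n k) := by
  rw [descend_subgroupOf hΓ hΓ']
  refine ⟨fun h γ hγ => ?_, fun h => ?_⟩
  · have hθ := congrArg Subtype.val
      (h ⟨_, Subgroup.mem_map_of_mem (descendHom hΓ) (x := ⟨γ, hΓ' hγ⟩⁻¹) (inv_mem hγ)⟩)
    exact (descendRep_descendHom hΓ _ θ).symm.trans hθ
  · rintro ⟨_, γ, hγ, rfl⟩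
    exact Subtype.ext ((descendRep_descendHom hΓ γ θ).trans (h _ (inv_mem hγ)))

/-- The eigenforms on the orbifold `Γ' \ ℝⁿ` are the invariant eigenforms on the torus. -/
def fixedVectorsEquivEigenforms [DiscreteTopology Λ] (hΓ : Γ ≤ latticeNormalizer Λ) (hΓ' : Γ' ≤ Γ)
    (hΛ : translations Λ ≤ Γ') (k : ℕ) (c : ℝ) :
    fixedVectors (V := eigenforms (translations Λ) k c) (descendRep hΓ k c)
        ((descend Λ Γ').subgroupOf (descend Λ Γ)) ≃ₗ[ℝ]
      eigenforms Γ' k c where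
  toFun θ := ⟨θ.1, θ.1.2.1, (mem_fixedVectors_descendRep_iff hΓ hΓ').1 θ.2, θ.1.2.2.2⟩
  map_add' _ _ := rfl
  map_smul' _ _ := rfl
  invFun θ := ⟨⟨θ, θ.2.1, fun γ hγ => θ.2.2.1 γ (hΛ hγ), θ.2.2.2⟩,
    (mem_fixedVectors_descendRep_iff hΓ hΓ').2 θ.2.2.1⟩
  left_inv _ := rfl
  right_inv _ := rfl

theorem isospectralOnForms_of_almostConjugate_descend {ι : Type*} [Finite ι]
    (b : Module.Basis ι ℝ (EuclideanSpace ℝ (Fin n)))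
    (hΛ : Λ = (Submodule.span ℤ (Set.range b)).toAddSubgroup)
    {Γ₁ Γ₂ : Subgroup (EuclideanSpace ℝ (Fin n) ≃ᵢ EuclideanSpace ℝ (Fin n))}
    (hΓ : Γ ≤ latticeNormalizer Λ) (hΓ₁ : Γ₁ ≤ Γ) (hΓ₂ : Γ₂ ≤ Γ)
    (hΛ₁ : translations Λ ≤ Γ₁) (hΛ₂ : translations Λ ≤ Γ₂)
    (h : AlmostConjugate ((descend Λ Γ₁).subgroupOf (descend Λ Γ))
      ((descend Λ Γ₂).subgroupOf (descend Λ Γ))) (k : ℕ) : IsospectralOnForms Γ₁ Γ₂ k := by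
  subst hΛ
  intro c
  have := finiteDimensional_eigenforms (b := b) le_rfl k c
  refine ⟨finiteDimensional_eigenforms hΛ₁ k c, finiteDimensional_eigenforms hΛ₂ k c, ?_⟩
  rw [← (fixedVectorsEquivEigenforms hΓ hΓ₁ hΛ₁ k c).finrank_eq,
    ← (fixedVectorsEquivEigenforms hΓ hΓ₂ hΛ₂ k c).finrank_eq]
  exact finrank_fixedVectors_eq_of_almostConjugate _ h

end Sunada

section Circles

variable {X : Type*} [PseudoMetricSpace X] {Γ : Subgroup (X ≃ᵢ X)}

theorem exists_addCircle_coe_eq_abs_sub_eq_dist {ℓ : ℝ} (s t : AddCircle ℓ) :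
    ∃ a b : ℝ, (a : AddCircle ℓ) = s ∧ (b : AddCircle ℓ) = t ∧ |a - b| = dist s t := by
  obtain ⟨a, rfl⟩ := QuotientAddGroup.mk_surjective s
  obtain ⟨b, rfl⟩ := QuotientAddGroup.mk_surjective t
  refine ⟨a - round (ℓ⁻¹ * (a - b)) * ℓ, b, ?_, rfl, ?_⟩
  · rw [← sub_eq_zero, ← AddCircle.coe_sub, AddCircle.coe_eq_zero_iff]
    exact ⟨-round (ℓ⁻¹ * (a - b)), by simp⟩
  · rw [dist_eq_norm, ← AddCircle.coe_sub, AddCircle.norm_eq]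
    congr 1
    ring

theorem addCircle_coe_eq_coe_iff {ℓ s t : ℝ} :
    (s : AddCircle ℓ) = t ↔ ∃ a : ℤ, s - t = a * ℓ := by
  rw [← sub_eq_zero, ← AddCircle.coe_sub, AddCircle.coe_eq_zero_iff]
  simp only [zsmul_eq_mul, eq_comm]

theorem orbitDist_eq_of_forall_le {x y : X} (h : ∀ γ ∈ Γ, dist x y ≤ dist x (γ y)) :
    orbitDist Γ (proj Γ x) (proj Γ y) = dist x y := by
  refine IsLeast.csInf_eq ⟨⟨x, y, rfl, rfl, rfl⟩, ?_⟩
  rintro _ ⟨x', y', hx, hy, rfl⟩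
  obtain ⟨γ, hγ, rfl⟩ := proj_eq_proj_iff.1 hx
  obtain ⟨δ, hδ, rfl⟩ := proj_eq_proj_iff.1 hy
  calc dist x y ≤ dist x ((γ⁻¹ * δ) y) := h _ (mul_mem (inv_mem hγ) hδ)
    _ = dist (γ x) (γ (γ.symm (δ y))) := (γ.dist_eq _ _).symm
    _ = dist (γ x) (δ y) := by rw [γ.apply_symm_apply]

theorem isDisjointUnionOfCircles_of_curves [T2Space (OrbitSpace Γ)] {S : Set (OrbitSpace Γ)}
    {m : ℕ} {ℓ ε : ℝ} (hℓ : 0 < ℓ) (hε : 0 < ε) {c : Fin m → ℝ → X} (hc : ∀ i, Isometry (c i))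
    (hS : ∀ p, p ∈ S ↔ ∃ i s, proj Γ (c i s) = p)
    (horb : ∀ i j s t, proj Γ (c i s) = proj Γ (c j t) ↔ i = j ∧ (s : AddCircle ℓ) = t)
    (hdist : ∀ i s t, ∀ γ ∈ Γ, |s - t| < ε → |s - t| ≤ dist (c i s) (γ (c i t))) :
    IsDisjointUnionOfCircles Γ S m ℓ := by
  have : Fact (0 < ℓ) := ⟨hℓ⟩
  let f (i : Fin m) : AddCircle ℓ → S := Quotient.lift
    (fun s => ⟨proj Γ (c i s), (hS _).2 ⟨i, s, rfl⟩⟩) fun s t h =>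
      Subtype.ext ((horb i i s t).2 ⟨rfl, Quotient.sound h⟩)
  have continuous_f (i) : Continuous (f i) :=
    Continuous.quotient_lift (((continuous_proj Γ).comp (hc i).continuous).subtype_mk _) _
  let g (p : Fin m × AddCircle ℓ) : S := f p.1 p.2
  have continuous_g : Continuous g := continuous_prod_of_discrete_left.2 continuous_f
  have bijective_g : Function.Bijective g := by
    constructor
    · rintro ⟨i, ⟨s⟩⟩ ⟨j, ⟨t⟩⟩ h
      obtain ⟨hij, hst⟩ := (horb i j s t).1 (congrArg Subtype.val h)
      exact Prod.ext hij hst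
    · rintro ⟨p, hp⟩
      obtain ⟨i, s, rfl⟩ := (hS p).1 hp
      exact ⟨(i, (s : AddCircle ℓ)), rfl⟩
  refine ⟨Continuous.homeoOfEquivCompactToT2 (f := Equiv.ofBijective g bijective_g) continuous_g,
    fun i t => ⟨Metric.ball t (ε / 2), Metric.ball_mem_nhds t (by positivity),
      fun s hs s' hs' => ?_⟩⟩
  obtain ⟨a, b, rfl, rfl, hab⟩ := exists_addCircle_coe_eq_abs_sub_eq_dist s s'
  have hlt : |a - b| < ε := by
    rw [hab]
    linarith [dist_triangle_right (a : AddCircle ℓ) b t, Metric.mem_ball.1 hs,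
      Metric.mem_ball.1 hs']
  have hcab : dist (c i a) (c i b) = |a - b| := (hc i).dist_eq a b
  change orbitDist Γ (proj Γ (c i a)) (proj Γ (c i b)) = _
  rw [← hab, ← hcab]
  exact orbitDist_eq_of_forall_le fun γ hγ => hcab ▸ hdist i a b γ hγ hlt

theorem IsDisjointUnionOfCircles.le_of_homeomorph {Y : Type*} [PseudoMetricSpace Y]
    {Γ' : Subgroup (Y ≃ᵢ Y)} {S : Set (OrbitSpace Γ)} {S' : Set (OrbitSpace Γ')} {m m' : ℕ}
    {ℓ ℓ' : ℝ} (h : IsDisjointUnionOfCircles Γ S m ℓ) (h' : IsDisjointUnionOfCircles Γ' S' m' ℓ')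
    (e : S ≃ₜ S') : m' ≤ m := by
  obtain ⟨f, -⟩ := h
  obtain ⟨f', -⟩ := h'
  let F : Fin m × AddCircle ℓ ≃ₜ Fin m' × AddCircle ℓ' := (f.trans e).trans f'.symm
  have fst_F (i) (t : AddCircle ℓ) : (F (i, t)).1 = (F (i, 0)).1 :=
    PreconnectedSpace.constant inferInstance
      (continuous_fst.comp (F.continuous.comp (Continuous.prodMk_right i)))
  have surjective_fst : Function.Surjective fun i : Fin m => (F (i, 0)).1 := fun j => by
    obtain ⟨⟨i, t⟩, hp⟩ := F.surjective (j, 0)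
    exact ⟨i, by simp only [← fst_F i t, hp]⟩
  simpa using Fintype.card_le_of_surjective _ surjective_fst

end Circles

section Lattices

variable {n : ℕ} {Λ Λ' : AddSubgroup (EuclideanSpace ℝ (Fin n))}

theorem compactSpace_torus {ι : Type*} [Finite ι]
    (b : Module.Basis ι ℝ (EuclideanSpace ℝ (Fin n))) :
    CompactSpace (Torus (Submodule.span ℤ (Set.range b)).toAddSubgroup) := by
  have hK : IsCompact (closure (ZSpan.fundamentalDomain b)) :=
    (ZSpan.fundamentalDomain_isBounded b).isCompact_closure
  refine isCompact_univ_iff.1 ((hK.image continuous_quotient_mk').of_isClosed_subset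
    isClosed_univ ?_)
  rintro ⟨x⟩ -
  obtain ⟨l, hl, -⟩ := ZSpan.exist_unique_vadd_mem_fundamentalDomain b x
  exact ⟨l + x, subset_closure hl, Quotient.sound' (QuotientAddGroup.leftRel_apply.2 (by simp))⟩

theorem compactSpace_orbitSpace [CompactSpace (Torus Λ)]
    {Γ : Subgroup (EuclideanSpace ℝ (Fin n) ≃ᵢ EuclideanSpace ℝ (Fin n))}
    (h : translations Λ ≤ Γ) : CompactSpace (OrbitSpace Γ) := by
  let f : Torus Λ → OrbitSpace Γ := Quotient.lift (proj Γ) fun x y hxy => Eq.symm <|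
    proj_eq_proj_iff.2 ⟨L (-x + y), h ⟨_, QuotientAddGroup.leftRel_apply.1 hxy, rfl⟩,
      add_neg_cancel_left x y⟩
  have continuous_f : Continuous f := Continuous.quotient_lift (continuous_proj Γ) _
  have surjective_f : Function.Surjective f := by
    rintro ⟨x⟩
    exact ⟨(x : Torus Λ), rfl⟩
  exact surjective_f.compactSpace continuous_f

theorem finite_setOf_mem_norm_le (Λ : AddSubgroup (EuclideanSpace ℝ (Fin n)))
    [DiscreteTopology Λ] (R : ℝ) : {l | l ∈ Λ ∧ ‖l‖ ≤ R}.Finite := by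
  refine (Metric.finite_isBounded_inter_isClosed ⟨inferInstance⟩ (Metric.isBounded_closedBall
    (x := (0 : EuclideanSpace ℝ (Fin n))) (r := R))
    (AddSubgroup.isClosed_of_discrete (H := Λ))).subset ?_
  rintro l ⟨hl, hR⟩
  exact ⟨mem_closedBall_zero_iff.2 hR, hl⟩

theorem discreteTopology_of_nsmul_mem [DiscreteTopology Λ'] {m : ℕ} (hm : m ≠ 0)
    (h : ∀ l ∈ Λ, m • l ∈ Λ') : DiscreteTopology Λ := by
  refine DiscreteTopology.of_continuous_injective (β := Λ')
    (f := fun l => ⟨m • (l : EuclideanSpace ℝ (Fin n)), h l l.2⟩) (by fun_prop) fun l l' hl => ?_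
  have hl' : m • (l : EuclideanSpace ℝ (Fin n)) = m • (l' : EuclideanSpace ℝ (Fin n)) :=
    congrArg Subtype.val hl
  rw [← Nat.cast_smul_eq_nsmul ℝ, ← Nat.cast_smul_eq_nsmul ℝ] at hl'
  exact Subtype.ext (smul_right_injective _ (Nat.cast_ne_zero.2 hm) hl')

theorem finite_quotient_of_nsmul_mem [DiscreteTopology Λ'] {m : ℕ} (hm : m ≠ 0)
    (h : ∀ l ∈ Λ, m • l ∈ Λ') : Finite (Λ ⧸ Λ'.addSubgroupOf Λ) := by
  have : DiscreteTopology (AddSubgroup.toIntSubmodule Λ) := discreteTopology_of_nsmul_mem hm h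
  have : AddGroup.FG Λ := Module.Finite.iff_addGroup_fg.1
    (instModuleFinite_of_discrete_submodule (AddSubgroup.toIntSubmodule Λ))
  refine AddCommGroup.finite_of_fg_isAddTorsion _ ?_
  rintro ⟨l⟩
  refine isOfFinAddOrder_iff_nsmul_eq_zero.2 ⟨m, hm.bot_lt, ?_⟩
  exact (QuotientAddGroup.eq_zero_iff _).2 (h l l.2)

theorem relIndex_eq_card_of_existsUnique {V ι : Type*} [AddCommGroup V] {Λ Λ' : AddSubgroup V}
    {r : ι → V} (hr : ∀ i, r i ∈ Λ) (h : ∀ l ∈ Λ, ∃! i, l - r i ∈ Λ') :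
    Λ'.relIndex Λ = Nat.card ι := by
  refine (Nat.card_eq_of_bijective
    (fun i => ((⟨r i, hr i⟩ : Λ) : Λ ⧸ Λ'.addSubgroupOf Λ)) ?_).symm
  have mk_eq_iff (i : ι) (l : Λ) :
      ((⟨r i, hr i⟩ : Λ) : Λ ⧸ Λ'.addSubgroupOf Λ) = l ↔ (l : V) - r i ∈ Λ' := by
    rw [QuotientAddGroup.eq, AddSubgroup.mem_addSubgroupOf]
    simp [sub_eq_neg_add]
  refine Function.bijective_iff_existsUnique _ |>.2 ?_
  rintro ⟨l⟩
  exact (existsUnique_congr fun i => mk_eq_iff i l).2 (h l l.2)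

end Lattices

section PointGroups

variable {n : ℕ} {Λ Λ' : AddSubgroup (EuclideanSpace ℝ (Fin n))}
  {B B' : EuclideanSpace ℝ (Fin n) ≃ᵢ EuclideanSpace ℝ (Fin n)}

/-- The group of the linear isometries of `ℝⁿ` which preserve `Λ`. -/
def pointGroup (Λ : AddSubgroup (EuclideanSpace ℝ (Fin n))) :
    Subgroup (EuclideanSpace ℝ (Fin n) ≃ᵢ EuclideanSpace ℝ (Fin n)) :=
  latticeNormalizer Λ ⊓ MulAction.stabilizer _ (0 : EuclideanSpace ℝ (Fin n))

theorem pointGroup_le_latticeNormalizer : pointGroup Λ ≤ latticeNormalizer Λ := inf_le_left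

theorem linearPart_apply_of_map_zero (hB : B 0 = 0) (x : EuclideanSpace ℝ (Fin n)) :
    linearPart B x = B x := by
  rw [apply_eq_linearPart_add B x, hB, add_zero]

theorem mem_pointGroup_iff : B ∈ pointGroup Λ ↔ B 0 = 0 ∧ ∀ l, l ∈ Λ ↔ B l ∈ Λ := by
  rw [pointGroup, Subgroup.mem_inf, mem_latticeNormalizer_iff, and_comm]
  exact and_congr_right fun hB => forall_congr' fun l => by rw [linearPart_apply_of_map_zero hB]

theorem map_add_of_mem_pointGroup (hB : B ∈ pointGroup Λ) (x y : EuclideanSpace ℝ (Fin n)) :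
    B (x + y) = B x + B y := by
  rw [apply_add, linearPart_apply_of_map_zero hB.2]

theorem norm_apply_of_mem_pointGroup (hB : B ∈ pointGroup Λ) (x : EuclideanSpace ℝ (Fin n)) :
    ‖B x‖ = ‖x‖ := by
  rw [← linearPart_apply_of_map_zero hB.2, LinearIsometryEquiv.norm_map]

theorem pointGroup_le_pointGroup_comap_nsmul (m : ℕ) :
    pointGroup Λ ≤ pointGroup (Λ.comap (nsmulAddMonoidHom m)) := fun B hB => by
  refine mem_pointGroup_iff.2 ⟨hB.2, fun l => ?_⟩
  simp only [AddSubgroup.mem_comap, nsmulAddMonoidHom_apply]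
  rw [← linearPart_apply_of_map_zero hB.2, ← map_nsmul, linearPart_apply_of_map_zero hB.2]
  exact (mem_pointGroup_iff.1 hB).2 _

theorem finite_pointGroup {ι : Type*} [Finite ι]
    (b : Module.Basis ι ℝ (EuclideanSpace ℝ (Fin n))) :
    Finite (pointGroup (Submodule.span ℤ (Set.range b)).toAddSubgroup) := by
  set Λ := (Submodule.span ℤ (Set.range b)).toAddSubgroup
  have finite_images : {v : ι → EuclideanSpace ℝ (Fin n) | ∀ i,
      v i ∈ {l | l ∈ Λ ∧ ‖l‖ ≤ ‖b i‖}}.Finite :=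
    Set.Finite.pi' fun i => finite_setOf_mem_norm_le Λ ‖b i‖
  have mapsTo : Set.MapsTo (fun B i => B (b i)) (pointGroup Λ : Set (_ ≃ᵢ _))
      {v : ι → EuclideanSpace ℝ (Fin n) | ∀ i, v i ∈ {l | l ∈ Λ ∧ ‖l‖ ≤ ‖b i‖}} := by
    intro B hB i
    have hb : b i ∈ Λ := Submodule.subset_span ⟨i, rfl⟩
    exact And.intro (((mem_pointGroup_iff.1 hB).2 (b i)).1 hb)
      (norm_apply_of_mem_pointGroup hB (b i)).le
  refine (Set.Finite.of_injOn mapsTo (fun B hB B' hB' h => ?_) finite_images).to_subtype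
  have hlin : (linearPart B).toLinearEquiv = (linearPart B').toLinearEquiv :=
    b.ext' fun i => by
      simpa [linearPart_apply_of_map_zero hB.2, linearPart_apply_of_map_zero hB'.2]
        using congrFun h i
  ext1 x
  rw [← linearPart_apply_of_map_zero hB.2, ← linearPart_apply_of_map_zero hB'.2]
  exact congrArg (fun f => f x) hlin

end PointGroups

section CrystalGroups

variable {n : ℕ} {Λ Λ' : AddSubgroup (EuclideanSpace ℝ (Fin n))}
  {K : Subgroup (EuclideanSpace ℝ (Fin n) ≃ᵢ EuclideanSpace ℝ (Fin n))}
  {B B' γ : EuclideanSpace ℝ (Fin n) ≃ᵢ EuclideanSpace ℝ (Fin n)}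
  {l l' : EuclideanSpace ℝ (Fin n)}

/-- The group generated by the translations by `Λ` and by `K`. When `K` is a finite group of linear
isometries which preserve the lattice `Λ`, this is the symmorphic crystallographic group with
lattice `Λ` and point group `K`. -/
def crystalGroup (Λ : AddSubgroup (EuclideanSpace ℝ (Fin n)))
    (K : Subgroup (EuclideanSpace ℝ (Fin n) ≃ᵢ EuclideanSpace ℝ (Fin n))) :
    Subgroup (EuclideanSpace ℝ (Fin n) ≃ᵢ EuclideanSpace ℝ (Fin n)) :=
  translations Λ ⊔ K

theorem translations_le_crystalGroup (h : Λ' ≤ Λ) : translations Λ' ≤ crystalGroup Λ K :=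
  (translations_mono h).trans le_sup_left

theorem crystalGroup_le_latticeNormalizer (hK : K ≤ latticeNormalizer Λ') :
    crystalGroup Λ K ≤ latticeNormalizer Λ' := by
  refine sup_le ?_ hK
  rintro _ ⟨l, -, rfl⟩
  exact L_mem_latticeNormalizer l

theorem mem_crystalGroup_iff (hK : K ≤ latticeNormalizer Λ) :
    γ ∈ crystalGroup Λ K ↔ ∃ B ∈ K, ∃ b ∈ Λ, γ = B * L b := by
  rw [crystalGroup, sup_comm, ← SetLike.mem_coe,
    Subgroup.coe_mul_of_left_le_normalizer_right _ _ hK, Set.mem_mul]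
  constructor
  · rintro ⟨B, hB, _, ⟨b, hb, rfl⟩, rfl⟩
    exact ⟨B, hB, b, hb, rfl⟩
  · rintro ⟨B, hB, b, hb, rfl⟩
    exact ⟨B, hB, L b, ⟨b, hb, rfl⟩, rfl⟩

theorem mem_descend_crystalGroup_iff (hK : K ≤ latticeNormalizer Λ) {f : Torus Λ' ≃ᵢ Torus Λ'} :
    f ∈ descend Λ' (crystalGroup Λ K) ↔ ∃ B ∈ K, ∃ b ∈ Λ, IsInducedBy Λ' f (B * L b) := by
  constructor
  · rintro ⟨γ, hγ, hf⟩
    obtain ⟨B, hB, b, hb, rfl⟩ := (mem_crystalGroup_iff hK).1 hγ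
    exact ⟨B, hB, b, hb, hf⟩
  · rintro ⟨B, hB, b, hb, hf⟩
    exact ⟨_, (mem_crystalGroup_iff hK).2 ⟨B, hB, b, hb, rfl⟩, hf⟩

theorem properlyDiscontinuousSMul_crystalGroup [DiscreteTopology Λ] [Finite K]
    (hK : K ≤ pointGroup Λ) :
    ProperlyDiscontinuousSMul (crystalGroup Λ K) (EuclideanSpace ℝ (Fin n)) := by
  refine ⟨fun {S S'} hS hS' => ?_⟩
  obtain ⟨R, hR⟩ := (hS.union hS').isBounded.exists_norm_le
  have finite_image : (Set.image2 (fun B l => B * L l) (K : Set (_ ≃ᵢ _))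
      {l | l ∈ Λ ∧ ‖l‖ ≤ 2 * R}).Finite :=
    (Set.toFinite _).image2 _ (finite_setOf_mem_norm_le Λ (2 * R))
  refine Set.Finite.of_finite_image (finite_image.subset ?_) Subtype.val_injective.injOn
  rintro _ ⟨⟨γ, hγ⟩, ⟨_, ⟨x, hx, rfl⟩, hx'⟩, rfl⟩
  obtain ⟨B, hB, l, hl, rfl⟩ :=
    (mem_crystalGroup_iff (hK.trans pointGroup_le_latticeNormalizer)).1 hγ
  have norm_le : ‖x + l‖ ≤ R := by
    rw [← norm_apply_of_mem_pointGroup (hK hB)]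
    exact hR _ (Or.inr hx')
  refine ⟨B, hB, l, ⟨hl, ?_⟩, rfl⟩
  calc ‖l‖ = ‖x + l - x‖ := by rw [add_sub_cancel_left]
    _ ≤ ‖x + l‖ + ‖x‖ := norm_sub_le _ _
    _ ≤ 2 * R := by linarith [hR x (Or.inl hx)]

theorem mul_L_eq_mul_L_iff (hB : B 0 = 0) (hB' : B' 0 = 0) :
    B * L l = B' * L l' ↔ B = B' ∧ l = l' := by
  refine ⟨fun h => ?_, fun ⟨hB, hl⟩ => hB ▸ hl ▸ rfl⟩
  have happly : B (-l + l) = B' (-l + l') := congrArg (fun γ : _ ≃ᵢ _ => γ (-l)) h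
  obtain rfl : l = l' := by
    rw [neg_add_cancel, hB, ← hB'] at happly
    exact neg_add_eq_zero.1 (B'.injective happly).symm
  exact ⟨mul_right_cancel h, rfl⟩

theorem exists_mul_L_eq_mul_L_mul_iff (hB : B 0 = 0) (hB' : B' 0 = 0) :
    (∃ m ∈ Λ, B * L l = B' * L l' * L m) ↔ B = B' ∧ l - l' ∈ Λ := by
  have L_mul_L (m) : L l' * L m = L (m + l') := by
    ext1 x
    exact add_assoc x m l'
  simp only [mul_assoc, L_mul_L, mul_L_eq_mul_L_iff hB hB', ← sub_eq_iff_eq_add]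
  exact ⟨fun ⟨_, hm, h, hl⟩ => ⟨h, hl ▸ hm⟩, fun ⟨h, hl⟩ => ⟨_, hl, h, rfl⟩⟩

theorem nonempty_equiv_descend_crystalGroup [DiscreteTopology Λ'] (hK : K ≤ pointGroup Λ)
    (hK' : K ≤ pointGroup Λ') :
    Nonempty (K × (Λ ⧸ Λ'.addSubgroupOf Λ) ≃ descend Λ' (crystalGroup Λ K)) := by
  have hK₀ := hK.trans pointGroup_le_latticeNormalizer
  have hΓ : crystalGroup Λ K ≤ latticeNormalizer Λ' :=
    crystalGroup_le_latticeNormalizer (hK'.trans pointGroup_le_latticeNormalizer)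
  let toCrystalGroup (p : K × Λ) : crystalGroup Λ K :=
    ⟨(p.1 : EuclideanSpace ℝ (Fin n) ≃ᵢ _) * L p.2,
      (mem_crystalGroup_iff hK₀).2 ⟨p.1, p.1.2, p.2, p.2.2, rfl⟩⟩
  have surjective_toCrystalGroup : Function.Surjective toCrystalGroup := by
    rintro ⟨γ, hγ⟩
    obtain ⟨B, hB, l, hl, rfl⟩ := (mem_crystalGroup_iff hK₀).1 hγ
    exact ⟨(⟨B, hB⟩, ⟨l, hl⟩), rfl⟩
  obtain ⟨e, -⟩ := exists_equiv_of_surjective (f := Prod.map id (QuotientAddGroup.mk' _))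
    (Function.surjective_id.prodMap (QuotientAddGroup.mk'_surjective (Λ'.addSubgroupOf Λ)))
    ((surjective_descendHom hΓ).comp surjective_toCrystalGroup) fun p q => by
      rw [Function.comp_apply, Function.comp_apply, descendHom_eq_descendHom_iff,
        exists_mul_L_eq_mul_L_mul_iff (hK p.1.2).2 (hK q.1.2).2, Prod.ext_iff,
        sub_eq_neg_add]
      exact and_congr Subtype.ext_iff (eq_comm.trans QuotientAddGroup.eq)
  exact ⟨e⟩

theorem natCard_descend_crystalGroup [DiscreteTopology Λ'] (hK : K ≤ pointGroup Λ)
    (hK' : K ≤ pointGroup Λ') :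
    Nat.card (descend Λ' (crystalGroup Λ K)) = Nat.card K * Λ'.relIndex Λ := by
  obtain ⟨e⟩ := nonempty_equiv_descend_crystalGroup hK hK'
  rw [← Nat.card_congr e, Nat.card_prod]
  rfl

theorem finite_descend_crystalGroup [DiscreteTopology Λ'] [Finite K] (hK : K ≤ pointGroup Λ)
    (hK' : K ≤ pointGroup Λ') {m : ℕ} (hm : m ≠ 0) (h : ∀ l ∈ Λ, m • l ∈ Λ') :
    Finite (descend Λ' (crystalGroup Λ K)) := by
  obtain ⟨e⟩ := nonempty_equiv_descend_crystalGroup hK hK'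
  have := finite_quotient_of_nsmul_mem hm h
  exact .of_equiv _ e

end CrystalGroups

section Involutions

theorem mem_closure_singleton_iff {M : Type*} [Group M] {g x : M} {m : ℕ} [NeZero m]
    (hm : orderOf g = m) : x ∈ Subgroup.closure {g} ↔ ∃ j : Fin m, g ^ (j : ℕ) = x := by
  classical
  have hg : IsOfFinOrder g := orderOf_pos_iff.1 (hm ▸ NeZero.pos m)
  rw [← Subgroup.zpowers_eq_closure, hg.mem_zpowers_iff_mem_range_orderOf, hm]
  simp only [Finset.mem_image, Finset.mem_range, Fin.exists_iff, exists_prop]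

theorem natCard_closure_singleton {M : Type*} [Group M] (g : M) :
    Nat.card (Subgroup.closure {g}) = orderOf g := by
  rw [← Subgroup.zpowers_eq_closure, Nat.card_zpowers]

theorem finite_closure_singleton {M : Type*} [Group M] {g : M} {m : ℕ} [NeZero m]
    (hm : orderOf g = m) : Finite (Subgroup.closure {g}) :=
  Nat.finite_of_card_ne_zero ((natCard_closure_singleton g).trans hm ▸ NeZero.ne m)

variable {n : ℕ} {Λ Λ' : AddSubgroup (EuclideanSpace ℝ (Fin n))}
  {κ γ : EuclideanSpace ℝ (Fin n) ≃ᵢ EuclideanSpace ℝ (Fin n)} {x y v l : EuclideanSpace ℝ (Fin n)}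

theorem closure_singleton_le_pointGroup (hκ : κ ∈ pointGroup Λ) :
    Subgroup.closure {κ} ≤ pointGroup Λ :=
  (Subgroup.closure_le _).2 (Set.singleton_subset_iff.2 hκ)

theorem mem_crystalGroup_closure_iff {m : ℕ} [NeZero m] (hκ : κ ∈ pointGroup Λ)
    (hm : orderOf κ = m) : γ ∈ crystalGroup Λ (Subgroup.closure {κ}) ↔
      ∃ j : Fin m, ∃ l ∈ Λ, γ = κ ^ (j : ℕ) * L l := by
  rw [mem_crystalGroup_iff
    ((closure_singleton_le_pointGroup hκ).trans pointGroup_le_latticeNormalizer)]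
  simp only [mem_closure_singleton_iff hm, exists_exists_eq_and]

theorem mem_descend_crystalGroup_closure_iff {m : ℕ} [NeZero m] (hκ : κ ∈ pointGroup Λ)
    (hm : orderOf κ = m) {f : Torus Λ' ≃ᵢ Torus Λ'} :
    f ∈ descend Λ' (crystalGroup Λ (Subgroup.closure {κ})) ↔
      ∃ j : Fin m, ∃ l ∈ Λ, IsInducedBy Λ' f (κ ^ (j : ℕ) * L l) := by
  rw [mem_descend_crystalGroup_iff
    ((closure_singleton_le_pointGroup hκ).trans pointGroup_le_latticeNormalizer)]
  simp only [mem_closure_singleton_iff hm, exists_exists_eq_and]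

theorem almostConjugate_descend_crystalGroup_closure [DiscreteTopology Λ']
    {Γ : Subgroup (EuclideanSpace ℝ (Fin n) ≃ᵢ EuclideanSpace ℝ (Fin n))} [Finite (descend Λ' Γ)]
    {κ' : EuclideanSpace ℝ (Fin n) ≃ᵢ EuclideanSpace ℝ (Fin n)} {m : ℕ} [NeZero m]
    (hκ : κ ∈ pointGroup Λ) (hκ' : κ' ∈ pointGroup Λ) (hm : orderOf κ = m) (hm' : orderOf κ' = m)
    (hΓ : Γ ≤ latticeNormalizer Λ') (hκΓ : crystalGroup Λ (Subgroup.closure {κ}) ≤ Γ)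
    (hκΓ' : crystalGroup Λ (Subgroup.closure {κ'}) ≤ Γ) (σ : Fin m → Λ ≃+ Λ)
    (hσ : ∀ j l, (σ j l : EuclideanSpace ℝ (Fin n)) ∈ Λ' ↔ (l : EuclideanSpace ℝ (Fin n)) ∈ Λ')
    (hconj : ∀ (j : Fin m) (l : Λ),
      ∃ δ ∈ Γ, δ * (κ ^ (j : ℕ) * L l) = κ' ^ (j : ℕ) * L (σ j l) * δ) :
    AlmostConjugate
      ((descend Λ' (crystalGroup Λ (Subgroup.closure {κ}))).subgroupOf (descend Λ' Γ))
      ((descend Λ' (crystalGroup Λ (Subgroup.closure {κ'}))).subgroupOf (descend Λ' Γ)) := by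
  let s₁ (p : Fin m × Λ) : crystalGroup Λ (Subgroup.closure {κ}) :=
    ⟨κ ^ (p.1 : ℕ) * L p.2, (mem_crystalGroup_closure_iff hκ hm).2 ⟨p.1, p.2, p.2.2, rfl⟩⟩
  let s₂ (p : Fin m × Λ) : crystalGroup Λ (Subgroup.closure {κ'}) :=
    ⟨κ' ^ (p.1 : ℕ) * L (σ p.1 p.2),
      (mem_crystalGroup_closure_iff hκ' hm').2 ⟨p.1, _, (σ p.1 p.2).2, rfl⟩⟩
  have surjective_s₁ : Function.Surjective s₁ := fun ⟨γ, hγ⟩ => by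
    obtain ⟨j, l, hl, rfl⟩ := (mem_crystalGroup_closure_iff hκ hm).1 hγ
    exact ⟨(j, ⟨l, hl⟩), rfl⟩
  have surjective_s₂ : Function.Surjective s₂ := fun ⟨γ, hγ⟩ => by
    obtain ⟨j, l, hl, rfl⟩ := (mem_crystalGroup_closure_iff hκ' hm').1 hγ
    obtain ⟨l', hl'⟩ := (σ j).surjective ⟨l, hl⟩
    exact ⟨(j, l'), Subtype.ext (by simp only [s₂, hl'])⟩
  have pow_eq_pow_iff {g : EuclideanSpace ℝ (Fin n) ≃ᵢ EuclideanSpace ℝ (Fin n)}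
      (hg : orderOf g = m) (i j : Fin m) : g ^ (i : ℕ) = g ^ (j : ℕ) ↔ i = j := by
    rw [pow_inj_mod, hg, Nat.mod_eq_of_lt i.2, Nat.mod_eq_of_lt j.2, Fin.ext_iff]
  refine almostConjugate_descend hΓ hκΓ hκΓ' surjective_s₁ surjective_s₂ ?_ fun p => hconj p.1 p.2
  rintro ⟨i, l⟩ ⟨j, l'⟩
  simp only [s₁, s₂, exists_mul_L_eq_mul_L_mul_iff (pow_mem hκ _).2 (pow_mem hκ _).2,
    exists_mul_L_eq_mul_L_mul_iff (pow_mem hκ' _).2 (pow_mem hκ' _).2, pow_eq_pow_iff hm,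
    pow_eq_pow_iff hm']
  refine and_congr_right ?_
  rintro rfl
  rw [← AddSubgroup.coe_sub, ← AddSubgroup.coe_sub, ← map_sub, hσ]

theorem apply_apply_of_orderOf_eq_two (h2 : orderOf κ = 2) (x : EuclideanSpace ℝ (Fin n)) :
    κ (κ x) = x := by
  have hsq : κ * κ = 1 := by rw [← pow_two, ← h2, pow_orderOf_eq_one]
  exact congrArg (fun γ : _ ≃ᵢ _ => γ x) hsq

theorem mul_L_apply_eq_self_iff (h2 : orderOf κ = 2) : (κ * L l) x = x ↔ l = κ x - x := by
  rw [eq_sub_iff_add_eq', ← κ.injective.eq_iff (a := x + l), apply_apply_of_orderOf_eq_two h2]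
  rfl

theorem eq_one_or_eq_of_apply_eq_self (hκ : κ ∈ pointGroup Λ) (h2 : orderOf κ = 2)
    (hγ : γ ∈ crystalGroup Λ (Subgroup.closure {κ})) (hx : γ x = x) :
    γ = 1 ∨ κ x - x ∈ Λ ∧ γ = κ * L (κ x - x) := by
  obtain ⟨j, l, hl, rfl⟩ := (mem_crystalGroup_closure_iff hκ h2).1 hγ
  fin_cases j
  · obtain rfl : l = 0 := add_eq_left.1 hx
    exact Or.inl (IsometryEquiv.ext add_zero)
  · obtain rfl := (mul_L_apply_eq_self_iff h2).1 hx
    exact Or.inr ⟨hl, rfl⟩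

theorem isotropy_ne_bot_iff (hκ : κ ∈ pointGroup Λ) (h2 : orderOf κ = 2) :
    isotropy (crystalGroup Λ (Subgroup.closure {κ})) x ≠ ⊥ ↔ κ x - x ∈ Λ := by
  rw [Subgroup.ne_bot_iff_exists_ne_one]
  constructor
  · rintro ⟨⟨⟨γ, hγ⟩, hx⟩, hne⟩
    refine ((eq_one_or_eq_of_apply_eq_self hκ h2 hγ hx).resolve_left fun h => hne ?_).1
    exact Subtype.ext (Subtype.ext h)
  · intro hx
    have hmem : κ * L (κ x - x) ∈ crystalGroup Λ (Subgroup.closure {κ}) :=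
      (mem_crystalGroup_closure_iff hκ h2).2 ⟨1, _, hx, by simp⟩
    refine ⟨⟨⟨_, hmem⟩, (mul_L_apply_eq_self_iff h2).2 rfl⟩, fun h => ?_⟩
    have hmul : κ * L (κ x - x) = 1 * L 0 :=
      (congrArg (fun g => g.1.1) h).trans (IsometryEquiv.ext fun z => (add_zero z).symm)
    have hne : κ ≠ 1 := fun h1 => by simp [h1] at h2
    exact hne ((mul_L_eq_mul_L_iff hκ.2 rfl).1 hmul).1

theorem nonempty_isotropy_mulEquiv (hκ : κ ∈ pointGroup Λ) (h2 : orderOf κ = 2)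
    (hx : isotropy (crystalGroup Λ (Subgroup.closure {κ})) x ≠ ⊥) :
    Nonempty (isotropy (crystalGroup Λ (Subgroup.closure {κ})) x ≃* Multiplicative (ZMod 2)) := by
  obtain ⟨g, hg⟩ := Subgroup.ne_bot_iff_exists_ne_one.1 hx
  have eq_of_ne_one (g : isotropy (crystalGroup Λ (Subgroup.closure {κ})) x) (hg : g ≠ 1) :
      g.1.1 = κ * L (κ x - x) :=
    ((eq_one_or_eq_of_apply_eq_self hκ h2 g.1.2 g.2).resolve_left fun h =>
      hg (Subtype.ext (Subtype.ext h))).2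
  have hcard : Nat.card (isotropy (crystalGroup Λ (Subgroup.closure {κ})) x) = 2 := by
    refine Nat.card_eq_two_iff.2 ⟨1, g, hg.symm, Set.eq_univ_of_forall fun g' => ?_⟩
    refine or_iff_not_imp_left.2 fun hg' => Subtype.ext (Subtype.ext ?_)
    exact (eq_of_ne_one g' hg').trans (eq_of_ne_one g hg).symm
  have : Fact (Nat.Prime 2) := ⟨Nat.prime_two⟩
  exact ⟨mulEquivOfPrimeCardEq hcard (by simp)⟩

theorem mem_singularSet_iff (hκ : κ ∈ pointGroup Λ) (h2 : orderOf κ = 2)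
    {p : OrbitSpace (crystalGroup Λ (Subgroup.closure {κ}))} :
    p ∈ singularSet (crystalGroup Λ (Subgroup.closure {κ})) ↔
      ∃ x, proj _ x = p ∧ κ x - x ∈ Λ := by
  simp only [singularSet, Set.mem_ofPred_eq, isotropy_ne_bot_iff hκ h2]

theorem apply_sub_mem (hκ : κ ∈ pointGroup Λ) (h2 : orderOf κ = 2)
    (hγ : γ ∈ crystalGroup Λ (Subgroup.closure {κ})) (hy : κ y - y ∈ Λ) : γ y - y ∈ Λ := by
  obtain ⟨j, l, hl, rfl⟩ := (mem_crystalGroup_closure_iff hκ h2).1 hγ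
  fin_cases j
  · exact (add_sub_cancel_left y l).symm ▸ hl
  · change κ (y + l) - y ∈ Λ
    rw [map_add_of_mem_pointGroup hκ, add_sub_right_comm]
    exact Λ.add_mem hy (((mem_pointGroup_iff.1 hκ).2 l).1 hl)

theorem proj_eq_proj_iff_sub_mem (hκ : κ ∈ pointGroup Λ) (h2 : orderOf κ = 2) (hy : κ y - y ∈ Λ) :
    proj (crystalGroup Λ (Subgroup.closure {κ})) x = proj _ y ↔ x - y ∈ Λ := by
  rw [proj_eq_proj_iff]
  constructor
  · rintro ⟨γ, hγ, rfl⟩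
    exact apply_sub_mem hκ h2 hγ hy
  · exact fun h => ⟨L (x - y), translations_le_crystalGroup le_rfl (L_mem_translations_iff.2 h),
      add_sub_cancel y x⟩

theorem apply_add_smul_sub_mem (hκ : κ ∈ pointGroup Λ) (hv : κ v = v) (hx : κ x - x ∈ Λ) (s : ℝ) :
    κ (x + s • v) - (x + s • v) ∈ Λ := by
  have hsv : κ (s • v) = s • v := by
    rw [← linearPart_apply_of_map_zero hκ.2, map_smul, linearPart_apply_of_map_zero hκ.2, hv]
  rwa [map_add_of_mem_pointGroup hκ, hsv, add_sub_add_right_eq_sub]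

theorem isDisjointUnionOfCircles_singularSet [DiscreteTopology Λ] (hκ : κ ∈ pointGroup Λ)
    (h2 : orderOf κ = 2) {ι : Type*} [Fintype ι] {ℓ : ℝ} (hℓ : 0 < ℓ)
    (hv : ‖v‖ = 1) (hκv : κ v = v)
    {p : ι → EuclideanSpace ℝ (Fin n)} (hp : ∀ i, κ (p i) - p i ∈ Λ)
    (hcover : ∀ x, κ x - x ∈ Λ → ∃ i, ∃ s : ℝ, x - (p i + s • v) ∈ Λ)
    (hdisj : ∀ i j, ∀ s : ℝ, p i - p j + s • v ∈ Λ ↔ i = j ∧ ∃ a : ℤ, s = a * ℓ) :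
    IsDisjointUnionOfCircles (crystalGroup Λ (Subgroup.closure {κ}))
      (singularSet (crystalGroup Λ (Subgroup.closure {κ}))) (Fintype.card ι) ℓ := by
  have := finite_closure_singleton h2
  have := properlyDiscontinuousSMul_crystalGroup (closure_singleton_le_pointGroup hκ)
  have : T2Space (OrbitSpace (crystalGroup Λ (Subgroup.closure {κ}))) :=
    t2Space_of_properlyDiscontinuousSMul_of_t2Space
  obtain ⟨r, hr, hΛ⟩ := exists_pos_forall_norm_lt_imp_eq_zero Λ
  let c (i : Fin (Fintype.card ι)) (s : ℝ) := p ((Fintype.equivFin ι).symm i) + s • v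
  have isometry_c (i) : Isometry (c i) := Isometry.of_dist_eq fun s t => by
    rw [dist_add_left, dist_eq_norm, ← sub_smul, norm_smul, hv, mul_one, Real.dist_eq,
      Real.norm_eq_abs]
  have hc (i s) : κ (c i s) - c i s ∈ Λ := apply_add_smul_sub_mem hκ hκv (hp _) s
  refine isDisjointUnionOfCircles_of_curves (ε := r / 2) hℓ (by positivity) isometry_c
    (fun q => ?_) (fun i j s t => ?_) fun i s t γ hγ hst => ?_
  · rw [mem_singularSet_iff hκ h2]
    refine ⟨?_, fun ⟨i, s, hq⟩ => ⟨c i s, hq, hc i s⟩⟩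
    rintro ⟨x, rfl, hx⟩
    obtain ⟨i, s, h⟩ := hcover x hx
    obtain ⟨i, rfl⟩ := (Fintype.equivFin ι).symm.surjective i
    exact ⟨i, s, ((proj_eq_proj_iff_sub_mem hκ h2 (hc i s)).2 h).symm⟩
  · rw [proj_eq_proj_iff_sub_mem hκ h2 (hc j t), addCircle_coe_eq_coe_iff,
      show c i s - c j t = _ from add_sub_add_comm _ _ _ _, ← sub_smul, hdisj,
      (Fintype.equivFin ι).symm.injective.eq_iff]
  · by_contra! hlt
    have hγt : γ (c i t) = c i t := sub_eq_zero.1 <| hΛ _ (apply_sub_mem hκ h2 hγ (hc i t)) <| by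
      have hdist : dist (c i t) (c i s) = |t - s| := (isometry_c i).dist_eq t s
      rw [← dist_eq_norm, dist_comm]
      linarith [dist_triangle (c i t) (c i s) (γ (c i t)), abs_sub_comm s t]
    rw [hγt, (isometry_c i).dist_eq, Real.dist_eq] at hlt
    exact lt_irrefl _ hlt

end Involutions

section Integers

/-- The additive group `ℤ ⊂ ℝ`, in which the coordinates of lattice vectors lie. -/
def integers : AddSubgroup ℝ := (Int.castAddHom ℝ).range

theorem mem_integers_iff {t : ℝ} : t ∈ integers ↔ ∃ a : ℤ, t = a :=
  exists_congr fun _ => eq_comm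

theorem mul_mem_integers_iff {c t : ℝ} (hc : c ≠ 0) : c * t ∈ integers ↔ ∃ a : ℤ, t = a / c := by
  simp only [mem_integers_iff, eq_div_iff hc, mul_comm]

theorem intCast_mul_mem_integers {t : ℝ} (a : ℤ) (ht : t ∈ integers) : a * t ∈ integers :=
  zsmul_eq_mul t a ▸ integers.zsmul_mem ht a

variable {m : ℕ} [NeZero m]

theorem exists_sub_div_mem_integers {t : ℝ} (ht : m * t ∈ integers) :
    ∃ i : Fin m, t - (i : ℕ) / m ∈ integers := by
  have hm : (m : ℝ) ≠ 0 := NeZero.ne _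
  obtain ⟨a, ha⟩ := mem_integers_iff.1 ht
  obtain ⟨i, hi⟩ := Int.eq_ofNat_of_zero_le (a.emod_nonneg (NeZero.ne (m : ℤ)))
  have hlt : i < m := by
    have := a.emod_lt_of_pos (Int.natCast_pos.2 (NeZero.pos m))
    lia
  have hdiv : (a : ℝ) = i + m * (a / m : ℤ) := by
    exact_mod_cast hi ▸ (Int.emod_add_mul_ediv a m).symm
  refine ⟨⟨i, hlt⟩, mem_integers_iff.2 ⟨a / m, mul_left_cancel₀ hm ?_⟩⟩
  rw [mul_sub, mul_div_cancel₀ _ hm]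
  linarith

theorem div_sub_div_mem_integers_iff {i j : Fin m} :
    ((i : ℕ) / m - (j : ℕ) / m : ℝ) ∈ integers ↔ i = j := by
  have hm : (m : ℝ) ≠ 0 := NeZero.ne _
  refine ⟨fun h => ?_, fun h => by rw [h, sub_self]; exact integers.zero_mem⟩
  obtain ⟨a, ha⟩ := mem_integers_iff.1 h
  have hdvd : (m : ℤ) ∣ (i : ℕ) - (j : ℕ) := by
    refine ⟨a, ?_⟩
    rw [← sub_div, div_eq_iff hm, mul_comm] at ha
    exact_mod_cast ha
  have := Nat.ModEq.eq_of_lt_of_lt ((Nat.modEq_iff_dvd.2 hdvd).symm) i.2 j.2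
  exact Fin.ext this

end Integers

section Lattice

/-- The coordinates on `ℝ³` with respect to the basis `(1,1,0)`, `(1,-1,0)`, `(0,0,√2)` of
`lattice'`, in which `τ`, `ρ` and `A` are signed permutations. -/
def frame : (Fin 3 → ℝ) ≃ₗ[ℝ] E3 where
  toFun y := !₂[y 0 + y 1, y 0 - y 1, √2 * y 2]
  map_add' y z := by ext i; fin_cases i <;> simp <;> ring
  map_smul' a y := by ext i; fin_cases i <;> simp <;> ring
  invFun x := ![(x 0 + x 1) / 2, (x 0 - x 1) / 2, x 2 / √2]
  left_inv y := by ext i; fin_cases i <;> simp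
  right_inv x := by ext i; fin_cases i <;> simp <;> field

theorem frame_apply (y : Fin 3 → ℝ) : frame y = !₂[y 0 + y 1, y 0 - y 1, √2 * y 2] := rfl

/-- The basis `(1,1,0)`, `(1,-1,0)`, `(0,0,√2)` of `ℝ³`, whose integral span is `lattice'`. -/
def frameBasis : Module.Basis (Fin 3) ℝ E3 := .ofEquivFun frame.symm

theorem lattice'_eq_span_frameBasis :
    lattice' = (Submodule.span ℤ (Set.range frameBasis)).toAddSubgroup := by
  have coe_frameBasis : ⇑frameBasis = ![!₂[1, 1, 0], !₂[1, -1, 0], !₂[0, 0, √2]] := by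
    ext i j
    fin_cases i <;> fin_cases j <;> simp [frameBasis, frame_apply]
  rw [coe_frameBasis, Submodule.span_int_eq_addSubgroupClosure, lattice']
  simp only [Matrix.range_cons, Matrix.range_empty, Set.union_empty, Set.singleton_union]

theorem frame_mem_lattice'_iff {y : Fin 3 → ℝ} :
    frame y ∈ lattice' ↔ y 0 ∈ integers ∧ y 1 ∈ integers ∧ y 2 ∈ integers := by
  rw [lattice'_eq_span_frameBasis, Submodule.mem_toAddSubgroup,
    frameBasis.mem_span_iff_repr_mem ℤ, Fin.forall_fin_succ, Fin.forall_fin_two]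
  simp only [frameBasis, Module.Basis.ofEquivFun_repr_apply, LinearEquiv.symm_apply_apply]
  rfl

theorem mem_lattice_iff {x : E3} :
    x ∈ lattice ↔ x 0 ∈ integers ∧ x 1 ∈ integers ∧ √2 * x 2 ∈ integers := by
  rw [mem_integers_iff, mem_integers_iff, mul_mem_integers_iff (by positivity)]
  rfl

theorem frame_mem_lattice_iff {y : Fin 3 → ℝ} :
    frame y ∈ lattice ↔ y 0 + y 1 ∈ integers ∧ y 0 - y 1 ∈ integers ∧ 2 * y 2 ∈ integers := by
  rw [mem_lattice_iff, show √2 * frame y 2 = 2 * y 2 by simp [frame_apply, ← mul_assoc]]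
  rfl

theorem two_mul_mem_integers_of_frame_mem_lattice {y : Fin 3 → ℝ} (hy : frame y ∈ lattice)
    (i : Fin 3) : 2 * y i ∈ integers := by
  obtain ⟨hadd, hsub, h2⟩ := frame_mem_lattice_iff.1 hy
  fin_cases i
  · exact (show 2 * y 0 = y 0 + y 1 + (y 0 - y 1) by ring) ▸ integers.add_mem hadd hsub
  · exact (show 2 * y 1 = y 0 + y 1 - (y 0 - y 1) by ring) ▸ integers.sub_mem hadd hsub
  · exact h2

theorem lattice'_le_lattice : lattice' ≤ lattice := frame.surjective.forall.2 fun y hy => by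
  obtain ⟨h0, h1, h2⟩ := frame_mem_lattice'_iff.1 hy
  exact frame_mem_lattice_iff.2 ⟨integers.add_mem h0 h1, integers.sub_mem h0 h1,
    by exact_mod_cast intCast_mul_mem_integers 2 h2⟩

theorem two_nsmul_mem_lattice' : ∀ l ∈ lattice, 2 • l ∈ lattice' :=
  frame.surjective.forall.2 fun y hy => by
    have h2 := two_mul_mem_integers_of_frame_mem_lattice hy
    rw [← map_nsmul, frame_mem_lattice'_iff]
    simpa using ⟨h2 0, h2 1, h2 2⟩

theorem lattice_le_quarterLattice' : lattice ≤ quarterLattice' := fun l hl =>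
  show 4 • l ∈ lattice' from
    (mul_smul 2 2 l : 4 • l = 2 • 2 • l) ▸ nsmul_mem (two_nsmul_mem_lattice' l hl) 2

-- As an instance it would give `Torus lattice'` a second metric structure.
theorem discreteTopology_lattice' : DiscreteTopology lattice' := by
  rw [lattice'_eq_span_frameBasis]
  exact inferInstanceAs (DiscreteTopology (Submodule.span ℤ (Set.range frameBasis)))

instance discreteTopology_lattice : DiscreteTopology lattice :=
  have := discreteTopology_lattice'
  discreteTopology_of_nsmul_mem two_ne_zero two_nsmul_mem_lattice'

instance compactSpace_torus_lattice' : CompactSpace (Torus lattice') := by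
  rw [lattice'_eq_span_frameBasis]
  exact compactSpace_torus frameBasis

theorem relIndex_lattice' : lattice'.relIndex lattice = 4 := by
  let r (p : Fin 2 × Fin 2) : E3 :=
    frame ![(p.1 : ℕ) / (2 : ℕ), (p.1 : ℕ) / (2 : ℕ), (p.2 : ℕ) / (2 : ℕ)]
  have r_mem (p) : r p ∈ lattice := by
    refine frame_mem_lattice_iff.2 ⟨⟨(p.1 : ℕ), ?_⟩, ⟨0, ?_⟩, ⟨(p.2 : ℕ), ?_⟩⟩ <;> simp; ring
  rw [relIndex_eq_card_of_existsUnique r_mem, Nat.card_prod, Nat.card_fin]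
  refine frame.surjective.forall.2 fun y hy => ?_
  have h2 := two_mul_mem_integers_of_frame_mem_lattice hy
  obtain ⟨i, hi⟩ := exists_sub_div_mem_integers (m := 2) (by exact_mod_cast h2 0)
  obtain ⟨j, hj⟩ := exists_sub_div_mem_integers (m := 2) (by exact_mod_cast h2 2)
  have hi' : y 1 - (i : ℕ) / (2 : ℕ) ∈ integers := by
    convert integers.sub_mem hi (frame_mem_lattice_iff.1 hy).2.1 using 1
    ring
  have sub_mem : frame y - r (i, j) ∈ lattice' := by
    rw [← map_sub, frame_mem_lattice'_iff]
    exact ⟨hi, hi', hj⟩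
  refine ⟨(i, j), sub_mem, fun q hq => ?_⟩
  have hdiff : r (i, j) - r q ∈ lattice' := by
    rw [← sub_sub_sub_cancel_left]
    exact lattice'.sub_mem hq sub_mem
  rw [← map_sub, frame_mem_lattice'_iff] at hdiff
  exact Prod.ext (div_sub_div_mem_integers_iff.1 hdiff.1).symm
    (div_sub_div_mem_integers_iff.1 hdiff.2.2).symm

end Lattice

section PointGroup

theorem linearIsometry_apply_zero {n : ℕ} {M : Matrix (Fin n) (Fin n) ℝ} (h : Mᵀ * M = 1) :
    linearIsometry M h 0 = 0 :=
  congrArg (WithLp.toLp 2) M.mulVec_zero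

theorem τ_apply (x : E3) : τ x = !₂[-x 1, -x 0, -x 2] := by
  change WithLp.toLp 2 (_ *ᵥ _) = _
  ext i
  fin_cases i <;> simp [Matrix.mulVec, dotProduct, Fin.sum_univ_three]

theorem ρ_apply (x : E3) : ρ x = !₂[-x 0, -x 1, x 2] := by
  change WithLp.toLp 2 (_ *ᵥ _) = _
  ext i
  fin_cases i <;> simp [Matrix.mulVec, dotProduct, Fin.sum_univ_three]

theorem A_apply (x : E3) :
    A x = !₂[(-x 0 - x 1) / 2 + x 2 / √2, (x 0 + x 1) / 2 + x 2 / √2, (x 0 - x 1) / √2] := by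
  change WithLp.toLp 2 (_ *ᵥ _) = _
  ext i
  fin_cases i <;> simp [Matrix.mulVec, dotProduct, Fin.sum_univ_three] <;> ring

theorem τ_frame (y : Fin 3 → ℝ) : τ (frame y) = frame ![-y 0, y 1, -y 2] := by
  ext i
  fin_cases i <;> simp [τ_apply, frame_apply] <;> ring

theorem ρ_frame (y : Fin 3 → ℝ) : ρ (frame y) = frame ![-y 0, -y 1, y 2] := by
  ext i
  fin_cases i <;> simp [ρ_apply, frame_apply] <;> ring

theorem A_frame (y : Fin 3 → ℝ) : A (frame y) = frame ![y 2, -y 0, y 1] := by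
  ext i
  fin_cases i <;> simp [A_apply, frame_apply] <;> field_simp <;> norm_num <;> ring

theorem τ_mem_pointGroup_lattice' : τ ∈ pointGroup lattice' := by
  refine mem_pointGroup_iff.2 ⟨linearIsometry_apply_zero _, frame.surjective.forall.2 fun y => ?_⟩
  simp [τ_frame, frame_mem_lattice'_iff]

theorem ρ_mem_pointGroup_lattice' : ρ ∈ pointGroup lattice' := by
  refine mem_pointGroup_iff.2 ⟨linearIsometry_apply_zero _, frame.surjective.forall.2 fun y => ?_⟩
  simp [ρ_frame, frame_mem_lattice'_iff]

theorem A_mem_pointGroup_lattice' : A ∈ pointGroup lattice' := by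
  refine mem_pointGroup_iff.2 ⟨linearIsometry_apply_zero _, frame.surjective.forall.2 fun y => ?_⟩
  rw [A_frame, frame_mem_lattice'_iff, frame_mem_lattice'_iff]
  change _ ↔ y 2 ∈ integers ∧ -y 0 ∈ integers ∧ y 1 ∈ integers
  rw [neg_mem_iff]
  tauto

theorem τ_mem_pointGroup_lattice : τ ∈ pointGroup lattice := by
  refine mem_pointGroup_iff.2 ⟨τ_mem_pointGroup_lattice'.2, fun x => ?_⟩
  simp [mem_lattice_iff, τ_apply, and_left_comm]

theorem ρ_mem_pointGroup_lattice : ρ ∈ pointGroup lattice := by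
  refine mem_pointGroup_iff.2 ⟨ρ_mem_pointGroup_lattice'.2, fun x => ?_⟩
  simp [mem_lattice_iff, ρ_apply]

theorem orderOf_τ : orderOf τ = 2 := by
  refine orderOf_eq_prime (IsometryEquiv.ext fun x => ?_) fun h => ?_
  · change τ (τ x) = x
    ext i
    fin_cases i <;> simp [τ_apply]
  · have h0 : τ !₂[1, 0, 0] 0 = 1 := by rw [h]; rfl
    norm_num [τ_apply] at h0

theorem orderOf_ρ : orderOf ρ = 2 := by
  refine orderOf_eq_prime (IsometryEquiv.ext fun x => ?_) fun h => ?_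
  · change ρ (ρ x) = x
    ext i
    fin_cases i <;> simp [ρ_apply]
  · have h0 : ρ !₂[1, 0, 0] 0 = 1 := by rw [h]; rfl
    norm_num [ρ_apply] at h0

instance finite_closure_τ : Finite (Subgroup.closure {τ}) := finite_closure_singleton orderOf_τ

instance finite_closure_ρ : Finite (Subgroup.closure {ρ}) := finite_closure_singleton orderOf_ρ

theorem H_le_pointGroup_lattice' : H ≤ pointGroup lattice' := by
  rw [H, Subgroup.closure_le]
  rintro _ (rfl | rfl | rfl)
  exacts [τ_mem_pointGroup_lattice', ρ_mem_pointGroup_lattice', A_mem_pointGroup_lattice']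

theorem H_le_pointGroup_quarterLattice' : H ≤ pointGroup quarterLattice' :=
  H_le_pointGroup_lattice'.trans (pointGroup_le_pointGroup_comap_nsmul 4)

instance finite_H : Finite H := by
  have : Finite (pointGroup lattice') := by
    rw [lattice'_eq_span_frameBasis]
    exact finite_pointGroup frameBasis
  exact Finite.of_injective _ (Subgroup.inclusion_injective H_le_pointGroup_lattice')

end PointGroup

section AlmostConjugate

/-- The automorphism `σ` of `ℝ³` such that `τ L_l` is conjugate to `ρ L_{σ l}` for all `l ∈ Λ`, by
`L_c A` for some `c` depending on `l`. -/
def shear : E3 ≃ₗ[ℝ] E3 :=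
  frame.symm.trans <| LinearEquiv.trans
    { toFun := fun y => ![y 2, y 2 + y 0 - y 1, y 1]
      map_add' := fun y z => by ext i; fin_cases i <;> simp; ring
      map_smul' := fun a y => by ext i; fin_cases i <;> simp; ring
      invFun := fun z => ![z 1 - z 0 + z 2, z 2, z 0]
      left_inv := fun y => by ext i; fin_cases i <;> simp; ring
      right_inv := fun z => by ext i; fin_cases i <;> simp; ring } frame

theorem shear_frame (y : Fin 3 → ℝ) : shear (frame y) = frame ![y 2, y 2 + y 0 - y 1, y 1] :=
  congrArg (fun z : Fin 3 → ℝ => frame ![z 2, z 2 + z 0 - z 1, z 1]) (frame.symm_apply_apply y)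

theorem shear_mem_lattice'_iff {x : E3} : shear x ∈ lattice' ↔ x ∈ lattice' := by
  obtain ⟨y, rfl⟩ := frame.surjective x
  rw [shear_frame, frame_mem_lattice'_iff, frame_mem_lattice'_iff]
  change y 2 ∈ integers ∧ y 2 + y 0 - y 1 ∈ integers ∧ y 1 ∈ integers ↔ _
  rw [show y 2 + y 0 - y 1 = y 0 + (y 2 - y 1) by ring]
  constructor
  · rintro ⟨h2, h, h1⟩
    exact ⟨(add_mem_cancel_right (integers.sub_mem h2 h1)).1 h, h1, h2⟩
  · rintro ⟨h0, h1, h2⟩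
    exact ⟨h2, integers.add_mem h0 (integers.sub_mem h2 h1), h1⟩

theorem shear_mem_lattice_iff {x : E3} : shear x ∈ lattice ↔ x ∈ lattice := by
  obtain ⟨y, rfl⟩ := frame.surjective x
  rw [shear_frame, frame_mem_lattice_iff, frame_mem_lattice_iff]
  change y 2 + (y 2 + y 0 - y 1) ∈ integers ∧ y 2 - (y 2 + y 0 - y 1) ∈ integers ∧
    2 * y 1 ∈ integers ↔ _
  rw [show y 2 + (y 2 + y 0 - y 1) = 2 * y 2 + (y 0 - y 1) by ring,
    show y 2 - (y 2 + y 0 - y 1) = -(y 0 - y 1) by ring, neg_mem_iff,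
    show y 0 + y 1 = y 0 - y 1 + 2 * y 1 by ring]
  constructor
  · rintro ⟨h, hsub, h1⟩
    exact ⟨integers.add_mem hsub h1, hsub, (add_mem_cancel_right hsub).1 h⟩
  · rintro ⟨h, hsub, h2⟩
    exact ⟨integers.add_mem h2 hsub, hsub, (add_mem_cancel_left hsub).1 h⟩

/-- The restriction of `shear` to `lattice`. -/
def latticeShear : lattice ≃+ lattice :=
  { shear.toEquiv.subtypeEquiv fun _ => shear_mem_lattice_iff.symm with
    map_add' := fun x y => Subtype.ext (map_add shear (x : E3) y) }

theorem L_mul_A_mul_τ_mul_L (y : Fin 3 → ℝ) :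
    L (frame ![0, (y 1 - y 2) / 2 - y 0, 0]) * A * (τ * L (frame y)) =
      ρ * L (shear (frame y)) * (L (frame ![0, (y 1 - y 2) / 2 - y 0, 0]) * A) := by
  refine IsometryEquiv.ext (frame.surjective.forall.2 fun z => ?_)
  change A (τ (frame z + frame y)) + frame _ = ρ (A (frame z) + frame _ + shear (frame y))
  rw [shear_frame, A_frame, ← map_add, ← map_add, ← map_add, ρ_frame, τ_frame, A_frame, ← map_add]
  congr 1
  ext i
  fin_cases i <;> simp; ring

theorem exists_mul_τ_mul_L_eq (l : lattice) :
    ∃ δ ∈ H ⊔ translations quarterLattice', δ * (τ * L l) = ρ * L (latticeShear l) * δ := by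
  obtain ⟨l, hl⟩ := l
  obtain ⟨y, rfl⟩ := frame.surjective l
  have hA : A ∈ H := Subgroup.subset_closure (Or.inr (Or.inr rfl))
  have hc : frame ![0, (y 1 - y 2) / 2 - y 0, 0] ∈ quarterLattice' := by
    have h2 := two_mul_mem_integers_of_frame_mem_lattice hl
    have h1 : 4 * ((y 1 - y 2) / 2 - y 0) ∈ integers := by
      rw [show 4 * ((y 1 - y 2) / 2 - y 0) = 2 * y 1 - 2 * y 2 - (2 * y 0 + 2 * y 0) by ring]
      exact sub_mem (sub_mem (h2 1) (h2 2)) (add_mem (h2 0) (h2 0))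
    change 4 • frame _ ∈ lattice'
    rw [← map_nsmul, frame_mem_lattice'_iff]
    simpa using h1
  exact ⟨_, mul_mem (le_sup_right (a := H) ⟨_, hc, rfl⟩) (le_sup_left (a := H) hA),
    L_mul_A_mul_τ_mul_L y⟩

end AlmostConjugate

section SunadaGroups

theorem G_eq_descend_crystalGroup : G = descend lattice' (crystalGroup quarterLattice' H) := by
  rw [G, crystalGroup, sup_comm]

theorem mem_G_iff {f : Torus lattice' ≃ᵢ Torus lattice'} :
    f ∈ G ↔ ∃ B ∈ H, ∃ b : E3, 4 • b ∈ lattice' ∧ IsInducedBy lattice' f (B * L b) := by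
  rw [G_eq_descend_crystalGroup, mem_descend_crystalGroup_iff
    (H_le_pointGroup_quarterLattice'.trans pointGroup_le_latticeNormalizer)]
  rfl

instance finite_G : Finite G := by
  have := discreteTopology_lattice'
  rw [G_eq_descend_crystalGroup]
  exact finite_descend_crystalGroup H_le_pointGroup_quarterLattice' H_le_pointGroup_lattice'
    four_ne_zero fun _ hl => hl

theorem Γ₁_le : Γ₁ ≤ H ⊔ translations quarterLattice' :=
  sup_le ((translations_mono lattice_le_quarterLattice').trans le_sup_right)
    (((Subgroup.closure_mono (k := {τ, ρ, A}) (by simp))).trans le_sup_left)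

theorem Γ₂_le : Γ₂ ≤ H ⊔ translations quarterLattice' :=
  sup_le ((translations_mono lattice_le_quarterLattice').trans le_sup_right)
    (((Subgroup.closure_mono (k := {τ, ρ, A}) (by simp))).trans le_sup_left)

theorem H_sup_translations_le_latticeNormalizer :
    H ⊔ translations quarterLattice' ≤ latticeNormalizer lattice' := by
  rw [sup_comm]
  exact crystalGroup_le_latticeNormalizer
    (H_le_pointGroup_lattice'.trans pointGroup_le_latticeNormalizer)

theorem almostConjugate_G₁_G₂ : AlmostConjugate (G₁.subgroupOf G) (G₂.subgroupOf G) := by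
  have := discreteTopology_lattice'
  have : Finite (descend lattice' (H ⊔ translations quarterLattice')) := finite_G
  refine almostConjugate_descend_crystalGroup_closure τ_mem_pointGroup_lattice
    ρ_mem_pointGroup_lattice orderOf_τ orderOf_ρ H_sup_translations_le_latticeNormalizer Γ₁_le Γ₂_le
    ![.refl _, latticeShear] (Fin.forall_fin_two.2 ⟨fun _ => Iff.rfl, fun _ =>
      shear_mem_lattice'_iff⟩) (Fin.forall_fin_two.2 ⟨fun l => ⟨1, one_mem _, ?_⟩, fun l => ?_⟩)
  · simp
  · exact exists_mul_τ_mul_L_eq l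

theorem natCard_G₁ : Nat.card G₁ = 8 := by
  have := discreteTopology_lattice'
  refine (natCard_descend_crystalGroup (closure_singleton_le_pointGroup τ_mem_pointGroup_lattice)
    (closure_singleton_le_pointGroup τ_mem_pointGroup_lattice')).trans ?_
  rw [natCard_closure_singleton, orderOf_τ, relIndex_lattice']

theorem natCard_G₂ : Nat.card G₂ = 8 := by
  have := discreteTopology_lattice'
  refine (natCard_descend_crystalGroup (closure_singleton_le_pointGroup ρ_mem_pointGroup_lattice)
    (closure_singleton_le_pointGroup ρ_mem_pointGroup_lattice')).trans ?_
  rw [natCard_closure_singleton, orderOf_ρ, relIndex_lattice']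

end SunadaGroups

section SingularSets

theorem τ_sub_mem_lattice_iff {x : E3} :
    τ x - x ∈ lattice ↔ 2 * (√2 * x 2) ∈ integers ∧ x 0 + x 1 ∈ integers := by
  rw [mem_lattice_iff, τ_apply]
  change -x 1 - x 0 ∈ integers ∧ -x 0 - x 1 ∈ integers ∧ √2 * (-x 2 - x 2) ∈ integers ↔ _
  rw [← neg_mem_iff (x := 2 * _), ← neg_mem_iff (x := x 0 + x 1),
    show -x 1 - x 0 = -(x 0 + x 1) by ring, show -x 0 - x 1 = -(x 0 + x 1) by ring,
    show √2 * (-x 2 - x 2) = -(2 * (√2 * x 2)) by ring]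
  tauto

theorem ρ_sub_mem_lattice_iff {x : E3} :
    ρ x - x ∈ lattice ↔ 2 * x 0 ∈ integers ∧ 2 * x 1 ∈ integers := by
  rw [mem_lattice_iff, ρ_apply]
  change -x 0 - x 0 ∈ integers ∧ -x 1 - x 1 ∈ integers ∧ √2 * (x 2 - x 2) ∈ integers ↔ _
  rw [← neg_mem_iff (x := 2 * x 0), ← neg_mem_iff (x := 2 * x 1),
    show -x 0 - x 0 = -(2 * x 0) by ring, show -x 1 - x 1 = -(2 * x 1) by ring, sub_self, mul_zero]
  simp [integers.zero_mem]

theorem isotropy_Γ₁_ne_bot_iff {x : E3} :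
    isotropy Γ₁ x ≠ ⊥ ↔ (∃ m : ℤ, x 2 = m / (2 * √2)) ∧ ∃ m : ℤ, x 0 + x 1 = m := by
  rw [← mul_mem_integers_iff (by positivity), ← mem_integers_iff, mul_assoc]
  exact (isotropy_ne_bot_iff τ_mem_pointGroup_lattice orderOf_τ).trans τ_sub_mem_lattice_iff

theorem isotropy_Γ₂_ne_bot_iff {x : E3} :
    isotropy Γ₂ x ≠ ⊥ ↔ (∃ m : ℤ, x 0 = m / 2) ∧ ∃ m : ℤ, x 1 = m / 2 := by
  rw [← mul_mem_integers_iff two_ne_zero, ← mul_mem_integers_iff two_ne_zero]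
  exact (isotropy_ne_bot_iff ρ_mem_pointGroup_lattice orderOf_ρ).trans ρ_sub_mem_lattice_iff

theorem isDisjointUnionOfCircles_singularSet_Γ₁ :
    IsDisjointUnionOfCircles Γ₁ (singularSet Γ₁) 2 √2 := by
  refine isDisjointUnionOfCircles_singularSet τ_mem_pointGroup_lattice orderOf_τ
    (v := !₂[1 / √2, -1 / √2, 0]) (p := fun i : Fin 2 => !₂[0, 0, (i : ℕ) / (2 : ℕ) / √2])
    (by positivity) ?_ ?_ (fun i => ?_) (fun x hx => ?_) fun i j s => ?_
  · simp [EuclideanSpace.norm_eq, Fin.sum_univ_three, div_pow, ← two_mul]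
  · ext i
    fin_cases i <;> simp [τ_apply, neg_div]
  · rw [τ_sub_mem_lattice_iff]
    exact ⟨⟨(i : ℕ), by simp; field⟩, ⟨0, by simp⟩⟩
  · obtain ⟨h2, h01⟩ := τ_sub_mem_lattice_iff.1 hx
    obtain ⟨i, hi⟩ := exists_sub_div_mem_integers (m := 2) (by exact_mod_cast h2)
    refine ⟨i, -(√2 * x 1), mem_lattice_iff.2 ⟨?_, ?_, ?_⟩⟩
    · convert h01 using 1
      simp
      field
    · convert integers.zero_mem using 1
      simp
      field
    · convert hi using 1
      simp
      field
  · rw [mem_lattice_iff, ← div_sub_div_mem_integers_iff (m := 2)]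
    simp only [← div_eq_iff (show √2 ≠ 0 by positivity), ← mem_integers_iff]
    change 0 - 0 + s * (1 / √2) ∈ integers ∧ 0 - 0 + s * (-1 / √2) ∈ integers ∧
      √2 * ((i : ℕ) / (2 : ℕ) / √2 - (j : ℕ) / (2 : ℕ) / √2 + s * 0) ∈ integers ↔ _
    rw [show 0 - 0 + s * (1 / √2) = s / √2 by ring, show 0 - 0 + s * (-1 / √2) = -(s / √2) by ring,
      neg_mem_iff, mul_zero, add_zero, ← sub_div, mul_div_cancel₀ _ (by positivity)]
    tauto

theorem isDisjointUnionOfCircles_singularSet_Γ₂ :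
    IsDisjointUnionOfCircles Γ₂ (singularSet Γ₂) 4 (1 / √2) := by
  refine isDisjointUnionOfCircles_singularSet ρ_mem_pointGroup_lattice orderOf_ρ
    (v := !₂[0, 0, 1])
    (p := fun i : Fin 2 × Fin 2 => !₂[(i.1 : ℕ) / (2 : ℕ), (i.2 : ℕ) / (2 : ℕ), 0])
    (by positivity) ?_ ?_ (fun i => ?_) (fun x hx => ?_) fun i j s => ?_
  · simp [EuclideanSpace.norm_eq, Fin.sum_univ_three]
  · ext i
    fin_cases i <;> simp [ρ_apply]
  · rw [ρ_sub_mem_lattice_iff]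
    exact ⟨⟨(i.1 : ℕ), by simp; field⟩, ⟨(i.2 : ℕ), by simp; field⟩⟩
  · obtain ⟨h0, h1⟩ := ρ_sub_mem_lattice_iff.1 hx
    obtain ⟨i, hi⟩ := exists_sub_div_mem_integers (m := 2) (by exact_mod_cast h0)
    obtain ⟨j, hj⟩ := exists_sub_div_mem_integers (m := 2) (by exact_mod_cast h1)
    refine ⟨(i, j), x 2, mem_lattice_iff.2 ?_⟩
    exact ⟨by simpa using hi, by simpa using hj, by simp [integers.zero_mem]⟩
  · rw [mem_lattice_iff, Prod.ext_iff, ← div_sub_div_mem_integers_iff (m := 2),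
      ← div_sub_div_mem_integers_iff (m := 2)]
    simp only [mul_one_div, ← mul_mem_integers_iff (show √2 ≠ 0 by positivity)]
    change (i.1 : ℕ) / (2 : ℕ) - (j.1 : ℕ) / (2 : ℕ) + s * 0 ∈ integers ∧
      (i.2 : ℕ) / (2 : ℕ) - (j.2 : ℕ) / (2 : ℕ) + s * 0 ∈ integers ∧
      √2 * (0 - 0 + s * 1) ∈ integers ↔ _
    rw [mul_zero, add_zero, add_zero, sub_zero, zero_add, mul_one, and_assoc]

end SingularSets

end FlatOrbifold

end

theorem mainTheorem8 :
    -- the crystallographic groups: explicit form, proper discontinuity, compact quotients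
    ((Γ₁ : Set (E3 ≃ᵢ E3)) = {γ | ∃ j : Fin 2, ∃ l ∈ lattice, γ = τ ^ (j : ℕ) * L l} ∧
      (Γ₂ : Set (E3 ≃ᵢ E3)) = {γ | ∃ j : Fin 2, ∃ l ∈ lattice, γ = ρ ^ (j : ℕ) * L l} ∧
      ProperlyDiscontinuousSMul Γ₁ E3 ∧ ProperlyDiscontinuousSMul Γ₂ E3 ∧
      CompactSpace (OrbitSpace Γ₁) ∧ CompactSpace (OrbitSpace Γ₂)) ∧
    -- all nontrivial isotropy groups are cyclic of order two
    (∀ x : E3, isotropy Γ₁ x ≠ ⊥ → Nonempty (isotropy Γ₁ x ≃* Multiplicative (ZMod 2))) ∧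
    (∀ x : E3, isotropy Γ₂ x ≠ ⊥ → Nonempty (isotropy Γ₂ x ≃* Multiplicative (ZMod 2))) ∧
    -- the points with nontrivial isotropy
    {x : E3 | isotropy Γ₁ x ≠ ⊥} =
      {x | (∃ m : ℤ, (x 2 : ℝ) = m / (2 * √2)) ∧ ∃ m : ℤ, (x 0 + x 1 : ℝ) = m} ∧
    {x : E3 | isotropy Γ₂ x ≠ ⊥} =
      {x | (∃ m : ℤ, (x 0 : ℝ) = m / 2) ∧ ∃ m : ℤ, (x 1 : ℝ) = m / 2} ∧
    -- the singular sets
    IsDisjointUnionOfCircles Γ₁ (singularSet Γ₁) 2 (√2) ∧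
    IsDisjointUnionOfCircles Γ₂ (singularSet Γ₂) 4 (1 / √2) ∧
    IsEmpty (singularSet Γ₁ ≃ₜ singularSet Γ₂) ∧
    -- Sunada isospectrality: quotients of a common compact torus by almost conjugate groups
    (lattice' ≤ lattice ∧ lattice'.relIndex lattice = 4 ∧ CompactSpace (Torus lattice')) ∧
    ((G₁ : Set (Torus lattice' ≃ᵢ Torus lattice')) =
        {f | ∃ j : Fin 2, ∃ l ∈ lattice, IsInducedBy lattice' f (τ ^ (j : ℕ) * L l)} ∧
      (G₂ : Set (Torus lattice' ≃ᵢ Torus lattice')) =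
        {f | ∃ j : Fin 2, ∃ l ∈ lattice, IsInducedBy lattice' f (ρ ^ (j : ℕ) * L l)} ∧
      (G : Set (Torus lattice' ≃ᵢ Torus lattice')) =
        {f | ∃ B ∈ H, ∃ b : E3, 4 • b ∈ lattice' ∧ IsInducedBy lattice' f (B * L b)}) ∧
    Nat.card G₁ = 8 ∧ Nat.card G₂ = 8 ∧
    Finite G ∧ G₁ ≤ G ∧ G₂ ≤ G ∧
    AlmostConjugate (G₁.subgroupOf G) (G₂.subgroupOf G) ∧
    OrbifoldIsometric Γ₁ G₁ ∧ OrbifoldIsometric Γ₂ G₂ ∧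
    -- isospectrality on `k`-forms for all `k`
    (∀ k : ℕ, IsospectralOnForms Γ₁ Γ₂ k) := by
  have := discreteTopology_lattice'
  have hτ := closure_singleton_le_pointGroup τ_mem_pointGroup_lattice
  have hρ := closure_singleton_le_pointGroup ρ_mem_pointGroup_lattice
  have hΛ₁ : translations lattice' ≤ Γ₁ := translations_le_crystalGroup lattice'_le_lattice
  have hΛ₂ : translations lattice' ≤ Γ₂ := translations_le_crystalGroup lattice'_le_lattice
  have hN := H_sup_translations_le_latticeNormalizer
  exact ⟨⟨Set.ext fun _ => mem_crystalGroup_closure_iff τ_mem_pointGroup_lattice orderOf_τ,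
      Set.ext fun _ => mem_crystalGroup_closure_iff ρ_mem_pointGroup_lattice orderOf_ρ,
      properlyDiscontinuousSMul_crystalGroup hτ, properlyDiscontinuousSMul_crystalGroup hρ,
      compactSpace_orbitSpace hΛ₁, compactSpace_orbitSpace hΛ₂⟩,
    fun _ => nonempty_isotropy_mulEquiv τ_mem_pointGroup_lattice orderOf_τ,
    fun _ => nonempty_isotropy_mulEquiv ρ_mem_pointGroup_lattice orderOf_ρ,
    Set.ext fun _ => isotropy_Γ₁_ne_bot_iff, Set.ext fun _ => isotropy_Γ₂_ne_bot_iff,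
    isDisjointUnionOfCircles_singularSet_Γ₁, isDisjointUnionOfCircles_singularSet_Γ₂,
    ⟨fun e => absurd (isDisjointUnionOfCircles_singularSet_Γ₁.le_of_homeomorph
      isDisjointUnionOfCircles_singularSet_Γ₂ e) (by norm_num)⟩,
    ⟨lattice'_le_lattice, relIndex_lattice', inferInstance⟩,
    ⟨Set.ext fun _ => mem_descend_crystalGroup_closure_iff τ_mem_pointGroup_lattice orderOf_τ,
      Set.ext fun _ => mem_descend_crystalGroup_closure_iff ρ_mem_pointGroup_lattice orderOf_ρ,
      Set.ext fun _ => mem_G_iff⟩,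
    natCard_G₁, natCard_G₂, finite_G, descend_mono Γ₁_le, descend_mono Γ₂_le, almostConjugate_G₁_G₂,
    orbifoldIsometric_descend hΛ₁ (Γ₁_le.trans hN), orbifoldIsometric_descend hΛ₂ (Γ₂_le.trans hN),
    isospectralOnForms_of_almostConjugate_descend frameBasis lattice'_eq_span_frameBasis hN Γ₁_le
      Γ₂_le hΛ₁ hΛ₂ almostConjugate_G₁_G₂⟩
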